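/- Let $K$ be a number field with ring of integers $\mathcal{O}$ and archimedean completions $K_1,\dots,K_r$, where $r\ge 2$. Put $G_i=\mathrm{SL}(2,K_i)$, $G=\prod_{i=1}^r G_i$, and let $\Gamma$ and $G_K$ be the images of $\mathrm{SL}(2,\mathcal{O})$ and $\mathrm{SL}(2,K)$ in $G$ under the diagonal embedding; let $\pi:G\to G/\Gamma$ be the projection. Let $D_i$ be the connected component of the identity of the diagonal subgroup of $G_i$ and $D_{i,\mathbb{R}}$ the connected component of the identity of the subgroup of real matrices in $D_i$. For a non-empty $I\subset\{1,\dots,r\}$ put $D_I=\prod_{i\in I}D_i$ and $D_{I,\mathbb{R}}=\prod_{i\in I}D_{i,\mathbb{R}}$, regarded as subgroups of $G$, and $D=D_{\{1,\dots,r\}}$. A torus in $G$ is a subgroup conjugate to a closed connected subgroup of $D$. The orbit $D_I\pi(g)$ is called locally divergent if for every $i\in I$ the orbit map $D_i\to G/\Gamma$, $h\mapsto h\pi(g)$, is proper. Let $\mathcal{N}_G(H)$ denote the normalizer of $H$ in $G$. Let $g\in G$. If $D_I\pi(g)$ is locally divergent, then $\overline{D_I\pi(g)}$ is an orbit of a torus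 if and only if $g\in\mathcal{N}_G(D_I)G_K$, and likewise $\overline{D_{I,\mathbb{R}}\pi(g)}$ is an orbit of a torus if and only if $g\in\mathcal{N}_G(D_I)G_K$. In particular, $D_I\pi(g)$ is locally divergent and $\overline{D_I\pi(g)}$ is not an orbit of a torus if and only if $$g\in\Big(\bigcap_{i\in I}\mathcal{N}_G(D_i)G_K\Big)\setminus\mathcal{N}_G(D_I)G_K.$$ -/

import Mathlib

open NumberField
open scoped Pointwise

noncomputable section

namespace HilbertModular

/-- The connected component of the identity of a subgroup `S` (with the induced topology),
as a subgroup of the ambient group. -/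
def identityComponent {H : Type*} [Group H] [TopologicalSpace H] [IsTopologicalGroup H]
    (S : Subgroup H) : Subgroup H :=
  (Subgroup.connectedComponentOfOne S).map S.subtype

section Local

variable {K : Type*} [Field K] (v : InfinitePlace K)

/-- `G_v = SL(2, K_v)`, where `K_v` is the completion of `K` at `v`. -/
abbrev LocalGroup : Type _ := Matrix.SpecialLinearGroup (Fin 2) v.Completion

/-- The subgroup of diagonal matrices of `G_v`. -/
def diagonalSubgroup : Subgroup (LocalGroup v) where
  carrier := {g | g 0 1 = 0 ∧ g 1 0 = 0}
  one_mem' := by simp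
  mul_mem' := by
    rintro a b ⟨ha, ha'⟩ ⟨hb, hb'⟩
    simp [Matrix.mul_apply, Fin.sum_univ_two, ha, ha', hb, hb']
  inv_mem' := by
    rintro a ⟨ha, ha'⟩
    simp [Matrix.SpecialLinearGroup.coe_inv, Matrix.adjugate_fin_two, ha, ha']

/-- The subgroup of real matrices of `G_v`; an element of `K_v` is real if its image in `ℂ`
under the (continuous, isometric) embedding of `K_v` is real. -/
def realSubgroup : Subgroup (LocalGroup v) where
  carrier := {g | ∀ i j, (InfinitePlace.Completion.extensionEmbedding v (g i j)).im = 0}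
  one_mem' := by
    intro i j
    by_cases h : i = j <;> simp [h]
  mul_mem' := by
    intro a b ha hb i j
    simp [Matrix.mul_apply, Fin.sum_univ_two, Complex.add_im, Complex.mul_im, ha _ _, hb _ _]
  inv_mem' := by
    intro a ha i j
    fin_cases i <;> fin_cases j <;>
      simp [Matrix.SpecialLinearGroup.coe_inv, Matrix.adjugate_fin_two, ha _ _]

/-- `D_v`: the connected component of the diagonal subgroup of `G_v`. -/
def localTorus : Subgroup (LocalGroup v) :=
  identityComponent (diagonalSubgroup v)

/-- `D_{v,ℝ}`: the connected component of the subgroup of real matrices in `D_v`. -/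
def localRealTorus : Subgroup (LocalGroup v) :=
  identityComponent (localTorus v ⊓ realSubgroup v)

end Local

section Global

variable (K : Type*) [Field K]

/-- `G = ∏_v SL(2, K_v)`, the product over all archimedean places of `K`. -/
abbrev Grp : Type _ := ∀ v : InfinitePlace K, LocalGroup v

/-- The diagonal embedding of `SL(2, K)` in `G`. -/
def diagonalEmbedding : Matrix.SpecialLinearGroup (Fin 2) K →* Grp K :=
  MonoidHom.pi fun v => Matrix.SpecialLinearGroup.map (algebraMap K v.Completion)

/-- `G_K`: the image of `SL(2, K)` in `G`. -/
def rationalSubgroup : Subgroup (Grp K) := (diagonalEmbedding K).range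

/-- `Γ`: the image of `SL(2, 𝓞 K)` in `G`. -/
def Gam : Subgroup (Grp K) :=
  ((diagonalEmbedding K).comp (Matrix.SpecialLinearGroup.map (algebraMap (𝓞 K) K))).range

/-- The Hilbert modular space `G / Γ`, with the quotient topology and the action of `G` by left
translations. -/
abbrev Space : Type _ := Grp K ⧸ Gam K

variable {K}

/-- The projection `π : G → G / Γ`. -/
def proj (g : Grp K) : Space K := (g : Grp K ⧸ Gam K)

/-- `D_I = ∏_{v ∈ I} D_v`, as a subgroup of `G` (the other components are trivial). -/
def torus (I : Set (InfinitePlace K)) : Subgroup (Grp K) :=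
  Subgroup.pi I (fun v => localTorus v) ⊓ Subgroup.pi Iᶜ (fun _ => ⊥)

/-- `D_{I,ℝ} = ∏_{v ∈ I} D_{v,ℝ}`, as a subgroup of `G` (the other components are trivial). -/
def realTorus (I : Set (InfinitePlace K)) : Subgroup (Grp K) :=
  Subgroup.pi I (fun v => localRealTorus v) ⊓ Subgroup.pi Iᶜ (fun _ => ⊥)

/-- A torus in `G`: a subgroup conjugate to a closed connected subgroup of `D`, the product of
all the `D_v`. -/
def IsTorus (T : Subgroup (Grp K)) : Prop :=
  ∃ (h : Grp K) (S : Subgroup (Grp K)), S ≤ torus Set.univ ∧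
    IsClosed (S : Set (Grp K)) ∧ IsConnected (S : Set (Grp K)) ∧
    T = S.map (MulAut.conj h).toMonoidHom

/-- `X` is an orbit of a torus. -/
def IsTorusOrbit (X : Set (Space K)) : Prop :=
  ∃ (T : Subgroup (Grp K)) (x : Space K), IsTorus T ∧ X = MulAction.orbit T x

/-- The orbit `H x` is divergent: the orbit map `h ↦ h x` is proper. -/
def IsDivergentOrbit (H : Subgroup (Grp K)) (x : Space K) : Prop :=
  IsProperMap (fun h : H => h • x)

/-- The orbit `D_I x` is locally divergent: `D_v x` is divergent for all `v ∈ I`. -/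
def IsLocallyDivergent (I : Set (InfinitePlace K)) (x : Space K) : Prop :=
  ∀ v ∈ I, IsDivergentOrbit (torus {v}) x

/-- `N_G(H) G_K`, the set of all products of an element normalizing `H` and one of `G_K`. -/
def normalizerMulRational (H : Subgroup (Grp K)) : Set (Grp K) :=
  (Subgroup.normalizer (H : Set (Grp K)) : Set (Grp K)) * (rationalSubgroup K : Set (Grp K))

end Global

end HilbertModular

end

/-!
The proof is elementary: geometry of numbers in `𝓞²`, the product formula, and one application of
Baire's theorem.

*Local divergence.* For `g ∈ G` and `w ∈ K²` let `height g w = ∏_v ‖g_v w‖_v^{n_v}`, where `n_v` is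
the local degree. Minkowski's theorem gives Mahler's criterion (`exists_bounded_mul_of_le_height`):
the `π(g)` for which `height g w` is bounded below on nonzero integral `w` form a relatively compact
set. Conversely, on a bounded set of `g` the product formula bounds the heights below. If `D_v π(g)`
is divergent, the points of each of its two ends have a vector of small height. Any two such vectors
are proportional, so by connectedness of the ray a single rational line is contracted along it,
which means that `g_v` maps this line to a coordinate axis. The two lines so obtained form a
rational matrix `γ` with `g_v γ` diagonal. Hence `D_v π(g)` is divergent if and only if
`g ∈ N_G(D_v) G_K` (`isDivergentOrbit_iff`); here `N_G(D_I)` is the set of the elements whose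
components in `I` are diagonal or antidiagonal.

*Orbits of rational points.* If `g = n γ` with `n ∈ N_G(D_I)` and `γ` rational, conjugation by `n`
reduces to the closure of `S π(γ)` for a connected subgroup `S` of `D`. The products of an entry of
the first row with one of the second are invariant under left multiplication by diagonal matrices,
and for `γ Γ` they lie in a discrete set. So near any point, all of `S γ Γ` comes from one
coset of `S U`, where `U` is the group of diagonal matrices fixing `π(γ)`. The closure of the
orbit is therefore the orbit of the closure `H` of `S U`, and also of the identity component of `H`,
which is open in `H` since `H` is the exponential image of a closed subgroup of a vector space
(`isTorusOrbit_closure_orbit`).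

*The converse.* Let the closure of the orbit be `T π(g)` for a torus `T`. By Baire's theorem, the
orbit map `T → T π(g)` is open. Hence `T` contains the positive diagonal matrices supported on `I`,
and as it is commutative, its components in `I` are diagonal. Suppose that `g_i β` is diagonal with
`β` rational, but `g_{i'} β` is neither diagonal nor antidiagonal, for some `i, i' ∈ I`. Then the
stabilizer of `π(g)` in `T` is contained in `{±1}`, hence `t ↦ t π(g)` is proper on `T`. But the
product formula shows that the flow which expands at `i`, and at `i'` contracts or expands at the
rate that compensates for this, keeps `π(g)` in a compact set: a contradiction
(`mem_normalizerMulRational_of_isTorusOrbit`).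
-/

noncomputable section

namespace HilbertModular

/-! ### Identity components -/

section IdentityComponent

variable {H : Type*} [Group H] [TopologicalSpace H] [IsTopologicalGroup H]

lemma identityComponent_le (S : Subgroup H) : identityComponent S ≤ S := by
  rintro _ ⟨x, -, rfl⟩
  exact x.2

lemma isConnected_identityComponent (S : Subgroup H) :
    IsConnected (identityComponent S : Set H) := by
  have h : IsConnected ((Subgroup.connectedComponentOfOne S : Subgroup S) : Set S) :=
    isConnected_connectedComponent
  exact h.image _ continuous_subtype_val.continuousOn

/-- The identity component of `S` contains all connected subsets of `S` through the identity. -/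
lemma mem_identityComponent {S : Subgroup H} {C : Set H} (hC : IsPreconnected C)
    (h1 : (1 : H) ∈ C) (hCS : C ⊆ S) : C ⊆ identityComponent S := by
  intro x hx
  have h : IsPreconnected (Subtype.val ⁻¹' C : Set S) := by
    refine Topology.IsInducing.subtypeVal.isPreconnected_image.mp ?_
    convert hC
    exact Set.image_preimage_eq_of_subset fun y hy => ⟨⟨y, hCS hy⟩, rfl⟩
  exact ⟨⟨x, hCS hx⟩, h.subset_connectedComponent (x := 1) h1 hx, rfl⟩

lemma isClosed_identityComponent {S : Subgroup H} (hS : IsClosed (S : Set H)) :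
    IsClosed (identityComponent S : Set H) :=
  hS.isClosedEmbedding_subtypeVal.isClosedMap _ isClosed_connectedComponent

/-- Continuous homomorphisms carry identity components into identity components. -/
lemma map_identityComponent_le {H' : Type*} [Group H'] [TopologicalSpace H']
    [IsTopologicalGroup H'] {S : Subgroup H} {S' : Subgroup H'} (φ : H →* H') (hφ : Continuous φ)
    (h : S.map φ ≤ S') : (identityComponent S).map φ ≤ identityComponent S' := by
  refine mem_identityComponent (C := φ '' identityComponent S)
    ((isConnected_identityComponent S).isPreconnected.image _ hφ.continuousOn)
    ⟨1, one_mem _, map_one _⟩ ?_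
  rintro _ ⟨x, hx, rfl⟩
  exact h ⟨x, identityComponent_le S hx, rfl⟩

end IdentityComponent

/-! ### Archimedean completions -/

section Completion

variable {K : Type*} [Field K] (v : InfinitePlace K)

local notation "ι" => InfinitePlace.Completion.extensionEmbedding

lemma norm_extensionEmbedding (x : v.Completion) : ‖ι v x‖ = ‖x‖ :=
  (InfinitePlace.Completion.isometry_extensionEmbedding v).norm_map_of_map_zero (map_zero _) x

lemma isClosedEmbedding_extensionEmbedding : Topology.IsClosedEmbedding (ι v) :=
  (InfinitePlace.Completion.isometry_extensionEmbedding v).isClosedEmbedding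

instance : ProperSpace v.Completion :=
  ProperSpace.of_isCompact_closedBall_of_le 0 fun x r _ => by
    have : Metric.closedBall x r = ι v ⁻¹' Metric.closedBall (ι v x) r := by
      ext y
      simp [(InfinitePlace.Completion.isometry_extensionEmbedding v).dist_eq]
    rw [this]
    exact (isClosedEmbedding_extensionEmbedding v).isCompact_preimage (isCompact_closedBall _ _)

/-- Completions contain the reals: their image in `ℂ` is closed and contains the rationals. -/
lemma exists_extensionEmbedding_eq_ofReal (t : ℝ) : ∃ x, ι v x = (t : ℂ) := by
  have hcl : IsClosed {t : ℝ | (t : ℂ) ∈ Set.range (ι v)} :=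
    (isClosedEmbedding_extensionEmbedding v).isClosed_range.preimage Complex.continuous_ofReal
  have hd : ∀ q : ℚ, (q : ℝ) ∈ {t : ℝ | (t : ℂ) ∈ Set.range (ι v)} := fun q =>
    ⟨(q : v.Completion), by simp⟩
  exact Rat.isDenseEmbedding_coe_real.dense.induction_on (p := fun t : ℝ => ∃ x, ι v x = (t : ℂ))
    t hcl hd

/-- The embedding of `ℝ` in a completion `K_v`, characterised by its compatibility with the
embedding of `K_v` in `ℂ`. -/
def realEmbedding : ℝ →+* v.Completion where
  toFun t := (exists_extensionEmbedding_eq_ofReal v t).choose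
  map_one' := (ι v).injective <| by
    rw [(exists_extensionEmbedding_eq_ofReal v 1).choose_spec]; simp
  map_zero' := (ι v).injective <| by
    rw [(exists_extensionEmbedding_eq_ofReal v 0).choose_spec]; simp
  map_mul' s t := (ι v).injective <| by
    rw [map_mul, (exists_extensionEmbedding_eq_ofReal v (s * t)).choose_spec,
      (exists_extensionEmbedding_eq_ofReal v s).choose_spec,
      (exists_extensionEmbedding_eq_ofReal v t).choose_spec, Complex.ofReal_mul]
  map_add' s t := (ι v).injective <| by
    rw [map_add, (exists_extensionEmbedding_eq_ofReal v (s + t)).choose_spec,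
      (exists_extensionEmbedding_eq_ofReal v s).choose_spec,
      (exists_extensionEmbedding_eq_ofReal v t).choose_spec, Complex.ofReal_add]

lemma extensionEmbedding_realEmbedding (t : ℝ) : ι v (realEmbedding v t) = t :=
  (exists_extensionEmbedding_eq_ofReal v t).choose_spec

lemma norm_realEmbedding (t : ℝ) : ‖realEmbedding v t‖ = |t| := by
  rw [← norm_extensionEmbedding, extensionEmbedding_realEmbedding, Complex.norm_real,
    Real.norm_eq_abs]

lemma continuous_realEmbedding : Continuous (realEmbedding v) := by
  rw [(isClosedEmbedding_extensionEmbedding v).continuous_iff]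
  simpa [Function.comp_def, extensionEmbedding_realEmbedding] using Complex.continuous_ofReal

end Completion

/-! ### The flows in `D` and the normalizers of the tori -/

section Flow

variable {K : Type*} [Field K]

lemma continuous_entry (v : InfinitePlace K) (i j : Fin 2) :
    Continuous (fun g : Grp K => g v i j) := by
  have h : Continuous (fun g : Grp K => (g v : Matrix (Fin 2) (Fin 2) v.Completion)) :=
    continuous_subtype_val.comp (continuous_apply v)
  exact h.matrix_elem i j

lemma continuous_localEntry (v : InfinitePlace K) (i j : Fin 2) :
    Continuous (fun g : LocalGroup v => g i j) :=
  (continuous_subtype_val : Continuous (fun g : LocalGroup v => g.1)).matrix_elem i j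

lemma continuous_localGroup {X : Type*} [TopologicalSpace X] {v : InfinitePlace K}
    {f : X → LocalGroup v} (h : ∀ i j, Continuous fun x => f x i j) : Continuous f :=
  Continuous.subtype_mk (continuous_matrix h) _

lemma det_eq_one {F : Type*} [Field F] (m : Matrix.SpecialLinearGroup (Fin 2) F) :
    m 0 0 * m 1 1 - m 0 1 * m 1 0 = 1 := by
  rw [← Matrix.det_fin_two]; exact m.det_coe

/-- The diagonal matrix with entries `e^s` and `e^{-s}` in `G_v`. -/
def boost (v : InfinitePlace K) (s : ℝ) : LocalGroup v :=
  ⟨!![realEmbedding v (Real.exp s), 0; 0, realEmbedding v (Real.exp (-s))], by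
    rw [Matrix.det_fin_two]
    simp [← map_mul, ← Real.exp_add]⟩

section
variable (v : InfinitePlace K) (s t : ℝ)

@[simp] lemma boost_zero_zero : boost v s 0 0 = realEmbedding v (Real.exp s) := rfl
@[simp] lemma boost_zero_one : boost v s 0 1 = 0 := rfl
@[simp] lemma boost_one_zero : boost v s 1 0 = 0 := rfl
@[simp] lemma boost_one_one : boost v s 1 1 = realEmbedding v (Real.exp (-s)) := rfl

lemma boost_zero : boost v 0 = 1 := by
  ext i j
  fin_cases i <;> fin_cases j <;> simp

lemma boost_add : boost v (s + t) = boost v s * boost v t := by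
  ext i j
  fin_cases i <;> fin_cases j <;>
    simp [Matrix.mul_apply, Fin.sum_univ_two, Real.exp_add, add_comm, mul_comm]

lemma continuous_boost : Continuous (boost v) := by
  refine continuous_localGroup fun i j => ?_
  have := continuous_realEmbedding v
  fin_cases i <;> fin_cases j <;> simp <;> fun_prop

lemma boost_mem_localTorus : boost v s ∈ localTorus v :=
  mem_identityComponent (isPreconnected_range (continuous_boost v)) ⟨0, boost_zero v⟩
    (by rintro _ ⟨t, rfl⟩; exact ⟨rfl, rfl⟩) ⟨s, rfl⟩

lemma boost_mem_localRealTorus : boost v s ∈ localRealTorus v := by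
  refine mem_identityComponent (isPreconnected_range (continuous_boost v)) ⟨0, boost_zero v⟩
    ?_ ⟨s, rfl⟩
  rintro _ ⟨t, rfl⟩
  refine ⟨boost_mem_localTorus v t, fun i j => ?_⟩
  fin_cases i <;> fin_cases j <;>
    simp [extensionEmbedding_realEmbedding, -Complex.ofReal_exp]

end

/-- The element of `G` whose component at `v` is `diag(e^{c v}, e^{-c v})`. -/
def flow (c : InfinitePlace K → ℝ) : Grp K := fun v => boost v (c v)

lemma flow_add (c d : InfinitePlace K → ℝ) : flow (c + d) = flow c * flow d :=
  funext fun v => boost_add v _ _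

lemma flow_zero : flow (0 : InfinitePlace K → ℝ) = 1 := funext fun v => boost_zero v

lemma continuous_flow_smul (c : InfinitePlace K → ℝ) : Continuous fun s : ℝ => flow (s • c) :=
  continuous_pi fun v => (continuous_boost v).comp (by fun_prop)

lemma localRealTorus_le (v : InfinitePlace K) : localRealTorus v ≤ localTorus v :=
  (identityComponent_le _).trans inf_le_left

lemma localTorus_le (v : InfinitePlace K) : localTorus v ≤ diagonalSubgroup v :=
  identityComponent_le _

lemma mem_torus {I : Set (InfinitePlace K)} {g : Grp K} :
    g ∈ torus I ↔ (∀ v ∈ I, g v ∈ localTorus v) ∧ ∀ v ∉ I, g v = 1 := by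
  simp [torus, Subgroup.mem_pi, Subgroup.mem_inf]

lemma mem_realTorus {I : Set (InfinitePlace K)} {g : Grp K} :
    g ∈ realTorus I ↔ (∀ v ∈ I, g v ∈ localRealTorus v) ∧ ∀ v ∉ I, g v = 1 := by
  simp [realTorus, Subgroup.mem_pi, Subgroup.mem_inf]

lemma realTorus_le (I : Set (InfinitePlace K)) : realTorus I ≤ torus I := fun g hg => by
  rw [mem_realTorus] at hg
  exact mem_torus.2 ⟨fun v hv => localRealTorus_le v (hg.1 v hv), hg.2⟩

lemma torus_le_univ (I : Set (InfinitePlace K)) : torus I ≤ torus Set.univ := fun g hg => by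
  rw [mem_torus] at *
  refine ⟨fun v _ => ?_, fun v hv => absurd (Set.mem_univ v) hv⟩
  by_cases hv : v ∈ I
  · exact hg.1 v hv
  · rw [hg.2 v hv]; exact one_mem _

lemma flow_mem_realTorus {I : Set (InfinitePlace K)} {c : InfinitePlace K → ℝ}
    (hc : ∀ v ∉ I, c v = 0) : flow c ∈ realTorus I :=
  mem_realTorus.2 ⟨fun v _ => boost_mem_localRealTorus v _, fun v hv => by
    rw [flow, hc v hv, boost_zero]⟩

lemma isConnected_torus (I : Set (InfinitePlace K)) : IsConnected (torus I : Set (Grp K)) := by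
  classical
  have : (torus I : Set (Grp K)) =
      Set.univ.pi fun v => if v ∈ I then (localTorus v : Set (LocalGroup v)) else {1} := by
    ext g
    rw [SetLike.mem_coe, mem_torus, Set.mem_univ_pi, ← forall_and]
    refine forall_congr' fun v => ?_
    by_cases hv : v ∈ I <;> simp [hv]
  rw [this]
  refine isConnected_univ_pi.2 fun v => ?_
  split_ifs
  · exact isConnected_identityComponent _
  · exact isConnected_singleton

lemma isConnected_realTorus (I : Set (InfinitePlace K)) :
    IsConnected (realTorus I : Set (Grp K)) := by
  classical
  have : (realTorus I : Set (Grp K)) =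
      Set.univ.pi fun v => if v ∈ I then (localRealTorus v : Set (LocalGroup v)) else {1} := by
    ext g
    rw [SetLike.mem_coe, mem_realTorus, Set.mem_univ_pi, ← forall_and]
    refine forall_congr' fun v => ?_
    by_cases hv : v ∈ I <;> simp [hv]
  rw [this]
  refine isConnected_univ_pi.2 fun v => ?_
  split_ifs
  · exact isConnected_identityComponent _
  · exact isConnected_singleton

lemma isClosed_diagonalSubgroup (v : InfinitePlace K) :
    IsClosed (diagonalSubgroup v : Set (LocalGroup v)) :=
  (isClosed_eq (continuous_localEntry v 0 1) continuous_const).inter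
    (isClosed_eq (continuous_localEntry v 1 0) continuous_const)

lemma isClosed_torus (I : Set (InfinitePlace K)) : IsClosed (torus I : Set (Grp K)) := by
  have : (torus I : Set (Grp K)) = (I.pi fun v => (localTorus v : Set (LocalGroup v))) ∩
      (Iᶜ.pi fun _ => {1}) := by
    ext g
    simp [mem_torus, Set.mem_pi]
  rw [this]
  exact (isClosed_set_pi fun v _ => isClosed_identityComponent (isClosed_diagonalSubgroup v)).inter
    (isClosed_set_pi fun v _ => isClosed_singleton)

/-- A matrix is monomial if each of its rows has a vanishing entry. In `SL(2)` these are
the diagonal and the antidiagonal matrices, that is, the normalizer of the diagonal subgroup. -/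
def IsMonomial {F : Type*} [Field F] (m : Matrix.SpecialLinearGroup (Fin 2) F) : Prop :=
  m 0 0 * m 0 1 = 0 ∧ m 1 0 * m 1 1 = 0

lemma IsMonomial.cases {F : Type*} [Field F] {m : Matrix.SpecialLinearGroup (Fin 2) F}
    (h : IsMonomial m) : (m 0 1 = 0 ∧ m 1 0 = 0) ∨ (m 0 0 = 0 ∧ m 1 1 = 0) := by
  have hd := det_eq_one m
  obtain ⟨h1, h2⟩ := h
  rcases mul_eq_zero.1 h1 with h1 | h1 <;> rcases mul_eq_zero.1 h2 with h2 | h2 <;>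
    simp_all

/-- The conjugate of a diagonal matrix which is not a scalar is diagonal only if the
conjugating matrix is monomial. -/
lemma isMonomial_of_conj_diagonal {F : Type*} [Field F]
    {m d e : Matrix.SpecialLinearGroup (Fin 2) F} (hd : d 0 1 = 0 ∧ d 1 0 = 0)
    (hne : d 0 0 ≠ d 1 1) (h : m * d = e * m) (he : e 0 1 = 0 ∧ e 1 0 = 0) : IsMonomial m := by
  have key (i j : Fin 2) := congrArg (fun x : Matrix.SpecialLinearGroup (Fin 2) F => x i j) h
  simp only [Matrix.SpecialLinearGroup.coe_mul, Matrix.mul_apply, Fin.sum_univ_two] at key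
  have h00 := key 0 0
  have h01 := key 0 1
  have h10 := key 1 0
  have h11 := key 1 1
  simp only [hd.1, hd.2, he.1, he.2, mul_zero, zero_mul, add_zero, zero_add] at h00 h01 h10 h11
  have hne' := sub_ne_zero.2 hne
  constructor
  · refine (mul_eq_zero.1 (?_ : (d 0 0 - d 1 1) * (m 0 0 * m 0 1) = 0)).resolve_left hne'
    linear_combination m 0 1 * h00 - m 0 0 * h01
  · refine (mul_eq_zero.1 (?_ : (d 0 0 - d 1 1) * (m 1 0 * m 1 1) = 0)).resolve_left hne'
    linear_combination m 1 1 * h10 - m 1 0 * h11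

lemma IsMonomial.conj_diagonal {F : Type*} [Field F]
    {m d : Matrix.SpecialLinearGroup (Fin 2) F} (hm : IsMonomial m)
    (hd : d 0 1 = 0 ∧ d 1 0 = 0) : (m * d * m⁻¹) 0 1 = 0 ∧ (m * d * m⁻¹) 1 0 = 0 := by
  rcases hm.cases with h | h <;>
    simp [Matrix.mul_apply, Fin.sum_univ_two, hd, h, Matrix.adjugate_fin_two]

lemma IsMonomial.inv {F : Type*} [Field F] {m : Matrix.SpecialLinearGroup (Fin 2) F}
    (h : IsMonomial m) : IsMonomial m⁻¹ := by
  rcases h.cases with h | h <;> simp [IsMonomial, Matrix.adjugate_fin_two, h]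

lemma conj_mem_torus {I : Set (InfinitePlace K)} {n : Grp K} (hn : ∀ v ∈ I, IsMonomial (n v))
    {d : Grp K} (hd : d ∈ torus I) : n * d * n⁻¹ ∈ torus I := by
  rw [mem_torus] at *
  refine ⟨fun v hv => ?_, fun v hv => by simp [hd.2 v hv]⟩
  have hcont : Continuous (MulAut.conj (n v)).toMonoidHom := by
    change Continuous fun x => n v * x * (n v)⁻¹
    fun_prop
  refine map_identityComponent_le (MulAut.conj (n v)).toMonoidHom hcont ?_ ⟨d v, hd.1 v hv, rfl⟩
  rintro _ ⟨x, hx, rfl⟩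
  exact (hn v hv).conj_diagonal hx

/-- The elements normalizing `D_I` are those whose components in `I` are monomial. -/
lemma mem_normalizer_torus {I : Set (InfinitePlace K)} {n : Grp K} :
    n ∈ Subgroup.normalizer (torus I : Set (Grp K)) ↔ ∀ v ∈ I, IsMonomial (n v) := by
  classical
  constructor
  · intro h v hv
    have hf : flow (Pi.single v (1 : ℝ)) ∈ torus I :=
      realTorus_le I (flow_mem_realTorus fun w hw => Pi.single_eq_of_ne (by grind) _)
    have h2 := (Subgroup.mem_normalizer_iff.1 h _).1 hf
    have h3 := localTorus_le v ((mem_torus.1 h2).1 v hv)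
    -- It is enough that one element of the torus that is not scalar stays diagonal.
    refine isMonomial_of_conj_diagonal (d := boost v 1) ⟨rfl, rfl⟩ ?_ ?_ h3
    · simp only [boost_zero_zero, boost_one_one, (realEmbedding v).injective.ne_iff]
      simp [Real.exp_eq_exp]
      norm_num
    · simp [flow]
  · intro h
    refine Subgroup.mem_normalizer_iff.2 fun d => ⟨fun hd => conj_mem_torus h hd, fun hd => ?_⟩
    have := conj_mem_torus (n := n⁻¹) (fun v hv => (h v hv).inv) hd
    simpa [mul_assoc] using this

/-- Membership in `N_G(D_I) G_K` requires a single rational matrix that makes all the components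
in `I` monomial. -/
lemma mem_normalizerMulRational {I : Set (InfinitePlace K)} {g : Grp K} :
    g ∈ normalizerMulRational (torus I) ↔
      ∃ γ, ∀ v ∈ I, IsMonomial ((g * diagonalEmbedding K γ) v) := by
  constructor
  · rintro ⟨n, hn, _, ⟨γ, rfl⟩, rfl⟩
    exact ⟨γ⁻¹, fun v hv => by simpa using mem_normalizer_torus.1 hn v hv⟩
  · rintro ⟨γ, h⟩
    exact ⟨_, mem_normalizer_torus.2 h, diagonalEmbedding K γ⁻¹, ⟨_, rfl⟩, by simp⟩

end Flow

/-! ### Short vectors -/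

section Minkowski

variable {K : Type*} [Field K]

open NumberField.mixedEmbedding MeasureTheory Module

/-- The vector `g_v w` of `K_v²`, for `g ∈ G` and `w ∈ K²`. -/
def evalVec (g : Grp K) (w : Fin 2 → K) (v : InfinitePlace K) : Fin 2 → v.Completion :=
  (g v).1.mulVec fun j => algebraMap K v.Completion (w j)

lemma evalVec_apply (g : Grp K) (w : Fin 2 → K) (v : InfinitePlace K) (i : Fin 2) :
    evalVec g w v i =
      g v i 0 * algebraMap K v.Completion (w 0) + g v i 1 * algebraMap K v.Completion (w 1) := by
  simp only [evalVec, Matrix.mulVec, dotProduct, Fin.sum_univ_two]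

/-- The vector of `K²` with given coordinates in `𝓞 K`. -/
def intVec (w : Fin 2 → 𝓞 K) : Fin 2 → K := fun j => algebraMap (𝓞 K) K (w j)

variable (K) in
/-- The identification of `∏_v K_v` with the mixed space `ℝ^r₁ × ℂ^r₂`. -/
def mixedMap : (∀ v : InfinitePlace K, v.Completion) →+* mixedSpace K :=
  (InfiniteAdeleRing.ringEquiv_mixedSpace K : InfiniteAdeleRing K →+* mixedSpace K)

lemma mixedMap_algebraMap (x : K) :
    mixedMap K (fun v : InfinitePlace K => algebraMap K v.Completion x) = mixedEmbedding K x :=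
  (InfiniteAdeleRing.mixedEmbedding_eq_algebraMap_comp K).symm

/-- The element `g` of `∏_v SL(2, K_v)` as a matrix over the mixed space `ℝ^r₁ × ℂ^r₂`. -/
def mixedMatrix (g : Grp K) : Matrix (Fin 2) (Fin 2) (mixedSpace K) :=
  fun i j => mixedMap K fun v => g v i j

lemma det_mixedMatrix (g : Grp K) : (mixedMatrix g).det = 1 := by
  rw [Matrix.det_fin_two]
  simp only [mixedMatrix]
  rw [← map_mul, ← map_mul, ← map_sub, ← map_one (mixedMap K)]
  congr 1
  funext v
  exact det_eq_one (g v)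

variable [NumberField K]

lemma det_mixedMatrix_toLin' (g : Grp K) :
    LinearMap.det ((Matrix.toLin' (mixedMatrix g)).restrictScalars ℝ) = 1 := by
  rw [LinearMap.det_restrictScalars, LinearMap.det_toLin', det_mixedMatrix, map_one]

lemma exists_intVec_of_mem_span {x : Fin 2 → mixedSpace K}
    (hx : x ∈ Submodule.span ℤ (Set.range (Pi.basis fun _ : Fin 2 => latticeBasis K))) :
    ∃ w : Fin 2 → 𝓞 K, ∀ j, x j = mixedEmbedding K (intVec w j) := by
  have h : ∀ j, x j ∈ mixedEmbedding.integerLattice K := by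
    induction hx using Submodule.span_induction with
    | mem x hx =>
      obtain ⟨⟨i, k⟩, rfl⟩ := hx
      intro j
      rw [Pi.basis_apply]
      by_cases hij : j = i
      · subst hij
        rw [Pi.single_eq_same, ← span_latticeBasis]
        exact Submodule.subset_span ⟨k, rfl⟩
      · rw [Pi.single_eq_of_ne hij]
        exact Submodule.zero_mem _
    | zero => intro j; exact Submodule.zero_mem _
    | add x y _ _ hx hy => intro j; exact Submodule.add_mem _ (hx j) (hy j)
    | smul a x _ hx => intro j; exact Submodule.smul_mem _ _ (hx j)
  choose w hw using h
  exact ⟨w, fun j => (hw j).symm⟩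

open scoped Classical in
lemma norm_le_norm_ringEquiv_mixedSpace (x : InfiniteAdeleRing K) (v : InfinitePlace K) :
    ‖x v‖ ≤ ‖InfiniteAdeleRing.ringEquiv_mixedSpace K x‖ := by
  rw [InfiniteAdeleRing.ringEquiv_mixedSpace_apply]
  by_cases hv : v.IsReal
  · refine le_trans ?_ (norm_fst_le _)
    refine le_trans (le_of_eq ?_) (norm_le_pi_norm _ ⟨v, hv⟩)
    exact ((InfinitePlace.Completion.isometry_extensionEmbeddingOfIsReal hv).norm_map_of_map_zero
      (map_zero _) _).symm
  · refine le_trans ?_ (norm_snd_le _)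
    refine le_trans (le_of_eq ?_)
      (norm_le_pi_norm _ ⟨v, InfinitePlace.not_isReal_iff_isComplex.1 hv⟩)
    exact (norm_extensionEmbedding v _).symm

open scoped Classical in
lemma norm_le_norm_mixedMap (x : ∀ v : InfinitePlace K, v.Completion) (v : InfinitePlace K) :
    ‖x v‖ ≤ ‖mixedMap K x‖ :=
  norm_le_norm_ringEquiv_mixedSpace x v

variable (K) in
/-- Minkowski's theorem for the lattices `g 𝓞²` in `∏_v K_v²`, uniformly in `g ∈ G`: as `G` acts
with determinant one, each of them has a nonzero vector of bounded norm. -/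
theorem exists_short_vector : ∃ C : ℝ, 0 < C ∧ ∀ g : Grp K, ∃ w : Fin 2 → 𝓞 K, w ≠ 0 ∧
    ∀ v i, ‖evalVec g (intVec w) v i‖ ≤ C := by
  classical
  borelize (Fin 2 → mixedSpace K)
  let E := Fin 2 → mixedSpace K
  let b := Pi.basis fun _ : Fin 2 => latticeBasis K
  let μ : Measure E := Measure.addHaar
  have hF : μ (ZSpan.fundamentalDomain b) < ⊤ :=
    (ZSpan.fundamentalDomain_isBounded b).measure_lt_top
  have hB : 0 < μ (Metric.ball (0 : E) 1) := Metric.measure_ball_pos _ _ one_pos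
  have hd : finrank ℝ E ≠ 0 := by
    have : Nontrivial E := inferInstance
    exact finrank_pos.ne'
  obtain ⟨C, hC0, hC⟩ : ∃ C : ℝ, 0 < C ∧ μ (ZSpan.fundamentalDomain b) * 2 ^ finrank ℝ E <
      μ (Metric.closedBall (0 : E) C) := by
    obtain ⟨n, hn⟩ := ENNReal.exists_nat_mul_gt hB.ne'
      (ENNReal.mul_ne_top hF.ne (ENNReal.pow_ne_top ENNReal.ofNat_ne_top) :
        μ (ZSpan.fundamentalDomain b) * 2 ^ finrank ℝ E ≠ ⊤)
    refine ⟨n + 1, by positivity, hn.trans_le ?_⟩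
    rw [Measure.addHaar_closedBall μ _ (by positivity)]
    gcongr
    rw [← ENNReal.ofReal_natCast]
    exact ENNReal.ofReal_le_ofReal ((by linarith : (n : ℝ) ≤ n + 1).trans
      (le_self_pow₀ (by linarith [n.cast_nonneg (α := ℝ)]) hd))
  refine ⟨C, hC0, fun g => ?_⟩
  let T := (Matrix.toLin' (mixedMatrix g)).restrictScalars ℝ
  have hs : μ (T ⁻¹' Metric.closedBall (0 : E) C) = μ (Metric.closedBall (0 : E) C) := by
    rw [Measure.addHaar_preimage_linearMap μ (by
      rw [det_mixedMatrix_toLin' g]; exact one_ne_zero),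
      det_mixedMatrix_toLin']
    simp
  have : Countable (Submodule.span ℤ (Set.range b)).toAddSubgroup := by
    change Countable (Submodule.span ℤ (Set.range b))
    infer_instance
  obtain ⟨⟨x, hx⟩, hx0, hxs⟩ := exists_ne_zero_mem_lattice_of_measure_mul_two_pow_lt_measure
    (ZSpan.isAddFundamentalDomain' b μ) (s := T ⁻¹' Metric.closedBall (0 : E) C) (by
      intro x hx
      simpa using hx)
    ((convex_closedBall (0 : E) C).linear_preimage T) (by rwa [hs])
  obtain ⟨w, hw⟩ := exists_intVec_of_mem_span hx
  refine ⟨w, ?_, fun v i => ?_⟩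
  · rintro rfl
    apply hx0
    ext1
    funext j
    simp [hw, intVec]
  · have h1 : T x i = mixedMap K fun v => evalVec g (intVec w) v i := by
      have : (fun v => evalVec g (intVec w) v i) =
        (fun v => g v i 0) * (fun v : InfinitePlace K => algebraMap K v.Completion (intVec w 0)) +
          (fun v => g v i 1) *
            (fun v : InfinitePlace K => algebraMap K v.Completion (intVec w 1)) := by
        funext v
        exact evalVec_apply g _ v i
      rw [this, map_add, map_mul, map_mul, mixedMap_algebraMap, mixedMap_algebraMap, ← hw, ← hw]
      simp only [T, LinearMap.restrictScalars_apply, Matrix.toLin'_apply, Matrix.mulVec,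
        dotProduct, Fin.sum_univ_two]
      rfl
    refine (norm_le_norm_mixedMap (fun v => evalVec g (intVec w) v i) v).trans ?_
    rw [← h1]
    refine (norm_le_pi_norm (T x) i).trans ?_
    simpa using hxs

end Minkowski

/-! ### Heights of vectors -/

section Height

variable {K : Type*} [Field K]

lemma norm_algebraMap (v : InfinitePlace K) (x : K) : ‖algebraMap K v.Completion x‖ = v x :=
  InfinitePlace.Completion.norm_coe v ((WithAbs.equiv v.1).symm x)

lemma evalVec_mul_diagonalEmbedding (g : Grp K) (γ : Matrix.SpecialLinearGroup (Fin 2) K)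
    (w : Fin 2 → K) :
    evalVec (g * diagonalEmbedding K γ) w = evalVec g (γ.1.mulVec w) := by
  funext v i
  simp only [evalVec_apply, diagonalEmbedding, Pi.mul_apply, Matrix.SpecialLinearGroup.coe_mul,
    Matrix.mul_apply, Fin.sum_univ_two, MonoidHom.pi_apply, Matrix.SpecialLinearGroup.map_apply_coe,
    RingHom.mapMatrix_apply, Matrix.map_apply, Matrix.mulVec, dotProduct, map_add, map_mul]
  ring

lemma evalVec_smul (g : Grp K) (a : K) (w : Fin 2 → K) (v : InfinitePlace K) :
    evalVec g (a • w) v = algebraMap K v.Completion a • evalVec g w v := by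
  funext i
  simp only [evalVec_apply, Pi.smul_apply, smul_eq_mul, map_mul]
  ring

lemma evalVec_mul (g h : Grp K) (w : Fin 2 → K) (v : InfinitePlace K) :
    evalVec (g * h) w v = (g v).1.mulVec (evalVec h w v) := by
  simp only [evalVec, Pi.mul_apply, Matrix.SpecialLinearGroup.coe_mul, Matrix.mulVec_mulVec]

lemma algebraMap_injective (v : InfinitePlace K) : Function.Injective (algebraMap K v.Completion) :=
  (algebraMap K v.Completion).injective

lemma mulVec_ne_zero {F : Type*} [Field F] (m : Matrix.SpecialLinearGroup (Fin 2) F)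
    {x : Fin 2 → F} (hx : x ≠ 0) : m.1.mulVec x ≠ 0 := by
  intro h
  apply hx
  have := congrArg (m⁻¹.1.mulVec) h
  rwa [Matrix.mulVec_mulVec, ← Matrix.SpecialLinearGroup.coe_mul, inv_mul_cancel,
    Matrix.SpecialLinearGroup.coe_one, Matrix.one_mulVec, Matrix.mulVec_zero] at this

lemma evalVec_ne_zero (g : Grp K) {w : Fin 2 → K} (hw : w ≠ 0) (v : InfinitePlace K) :
    evalVec g w v ≠ 0 :=
  mulVec_ne_zero _ fun h => hw <| funext fun j => by
    simpa only [Pi.zero_apply, map_eq_zero] using congrFun h j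

lemma intVec_ne_zero {w : Fin 2 → 𝓞 K} (hw : w ≠ 0) : intVec w ≠ 0 := fun h => hw <|
  funext fun j => RingOfIntegers.coe_eq_zero_iff.1 (congrFun h j)

lemma norm_mulVec_le {F : Type*} [NormedField F] {m : Matrix.SpecialLinearGroup (Fin 2) F} {R : ℝ}
    (hm : ∀ i j, ‖m i j‖ ≤ R) (x : Fin 2 → F) : ‖m.1.mulVec x‖ ≤ 2 * R * ‖x‖ := by
  have hR : 0 ≤ R := (norm_nonneg _).trans (hm 0 0)
  rw [pi_norm_le_iff_of_nonneg (by positivity)]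
  intro i
  simp only [Matrix.mulVec, dotProduct, Fin.sum_univ_two]
  refine (norm_add_le _ _).trans ?_
  rw [norm_mul, norm_mul]
  have h0 := mul_le_mul (hm i 0) (norm_le_pi_norm x 0) (norm_nonneg _) hR
  have h1 := mul_le_mul (hm i 1) (norm_le_pi_norm x 1) (norm_nonneg _) hR
  linarith

lemma norm_inv_apply_le {F : Type*} [NormedField F] {m : Matrix.SpecialLinearGroup (Fin 2) F}
    {R : ℝ} (hm : ∀ i j, ‖m i j‖ ≤ R) (i j : Fin 2) : ‖m⁻¹ i j‖ ≤ R := by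
  fin_cases i <;> fin_cases j <;>
    simpa [Matrix.adjugate_fin_two] using hm _ _

/-- An element of `SL(2)` contracts vectors by a bounded factor, since the entries of its inverse
are those of the matrix, up to sign and order. -/
lemma norm_le_norm_mulVec {F : Type*} [NormedField F] {m : Matrix.SpecialLinearGroup (Fin 2) F}
    {R : ℝ} (hm : ∀ i j, ‖m i j‖ ≤ R) (x : Fin 2 → F) : ‖x‖ ≤ 2 * R * ‖m.1.mulVec x‖ := by
  have := norm_mulVec_le (norm_inv_apply_le hm) (m.1.mulVec x)
  rwa [Matrix.mulVec_mulVec, ← Matrix.SpecialLinearGroup.coe_mul, inv_mul_cancel,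
    Matrix.SpecialLinearGroup.coe_one, Matrix.one_mulVec] at this

variable [NumberField K]

/-- The normalized size `∏_v ‖g_v w‖_v^{n_v}` of `g w`; it does not change when `w` is multiplied
by a unit. -/
def height (g : Grp K) (w : Fin 2 → K) : ℝ := ∏ v, ‖evalVec g w v‖ ^ v.mult

lemma prod_norm_algebraMap (x : K) :
    ∏ v : InfinitePlace K, ‖algebraMap K v.Completion x‖ ^ v.mult = |(Algebra.norm ℚ x : ℝ)| := by
  simp_rw [norm_algebraMap]
  exact_mod_cast InfinitePlace.prod_eq_abs_norm x

lemma one_le_abs_norm {a : 𝓞 K} (ha : a ≠ 0) : 1 ≤ |(Algebra.norm ℚ (a : K) : ℝ)| := by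
  rw [← Algebra.coe_norm_int]
  have : Algebra.norm ℤ a ≠ 0 := Algebra.norm_ne_zero_iff.2 ha
  have := Int.one_le_abs this
  exact_mod_cast this

lemma one_le_prod_norm {a : 𝓞 K} (ha : a ≠ 0) :
    1 ≤ ∏ v : InfinitePlace K, ‖algebraMap K v.Completion (a : K)‖ ^ v.mult := by
  rw [prod_norm_algebraMap]; exact one_le_abs_norm ha

lemma eq_zero_of_norm_lt_one {a : 𝓞 K}
    (h : ∀ v : InfinitePlace K, ‖algebraMap K v.Completion (a : K)‖ < 1) : a = 0 := by
  by_contra ha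
  obtain ⟨v, hv⟩ : ∃ v : InfinitePlace K, True := ⟨Classical.arbitrary _, trivial⟩
  refine absurd (one_le_prod_norm ha) (not_le.2 ?_)
  calc _ < ∏ v : InfinitePlace K, (1 : ℝ) := by
        refine Finset.prod_lt_prod_of_nonempty (fun w _ => ?_) (fun w _ => ?_)
          Finset.univ_nonempty
        · rw [norm_algebraMap]
          exact pow_pos (InfinitePlace.pos_iff.2 (by simpa using ha)) _
        · exact pow_lt_one₀ (norm_nonneg _) (h w) w.mult_ne_zero
    _ = 1 := by simp

lemma height_nonneg (g : Grp K) (w : Fin 2 → K) : 0 ≤ height g w :=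
  Finset.prod_nonneg fun _ _ => by positivity

lemma height_smul (g : Grp K) (a : K) (w : Fin 2 → K) :
    height g (a • w) = |(Algebra.norm ℚ a : ℝ)| * height g w := by
  rw [← prod_norm_algebraMap, height, height, ← Finset.prod_mul_distrib]
  refine Finset.prod_congr rfl fun v _ => ?_
  rw [evalVec_smul, norm_smul, mul_pow]

lemma height_mul_diagonalEmbedding (g : Grp K) (γ : Matrix.SpecialLinearGroup (Fin 2) K)
    (w : Fin 2 → K) :
    height (g * diagonalEmbedding K γ) w = height g (γ.1.mulVec w) := by
  simp only [height, evalVec_mul_diagonalEmbedding]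

/-- The vectors `h w`, with `w` integral, are not small when `h` is bounded. -/
lemma one_le_mul_height {h : Grp K} {R : ℝ} (hR : ∀ v i j, ‖h v i j‖ ≤ R) {w : Fin 2 → 𝓞 K}
    (hw : w ≠ 0) : 1 ≤ (∏ v : InfinitePlace K, (2 * R) ^ v.mult) * height h (intVec w) := by
  obtain ⟨j, hj⟩ : ∃ j, w j ≠ 0 := by
    by_contra! h'
    exact hw (funext h')
  refine (one_le_prod_norm hj).trans ?_
  rw [height, ← Finset.prod_mul_distrib]
  refine Finset.prod_le_prod (fun v _ => by positivity) fun v _ => ?_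
  rw [← mul_pow]
  refine pow_le_pow_left₀ (norm_nonneg _) ?_ _
  refine le_trans ?_ (norm_le_norm_mulVec (hR v) _)
  exact norm_le_pi_norm (fun j => algebraMap K v.Completion (intVec w j)) j

end Height

/-! ### Topology of `G / Γ` -/

section Gamma

variable {K : Type*} [Field K]

lemma isCompact_entries_le (R : ℝ) : IsCompact {g : Grp K | ∀ v i j, ‖g v i j‖ ≤ R} := by
  have h (v : InfinitePlace K) : IsCompact {g : LocalGroup v | ∀ i j, ‖g i j‖ ≤ R} := by
    have : {g : LocalGroup v | ∀ i j, ‖g i j‖ ≤ R} = Subtype.val ⁻¹'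
        (Set.univ.pi fun _ : Fin 2 => Set.univ.pi fun _ : Fin 2 =>
          Metric.closedBall (0 : v.Completion) R) := by
      ext g
      exact ⟨fun h i _ j _ => mem_closedBall_zero_iff.2 (h i j),
        fun h i j => mem_closedBall_zero_iff.1 (h i trivial j trivial)⟩
    rw [this]
    exact Matrix.SpecialLinearGroup.isClosedEmbedding_val.isCompact_preimage
      (isCompact_univ_pi fun _ => isCompact_univ_pi fun _ => isCompact_closedBall _ _)
  have : {g : Grp K | ∀ v i j, ‖g v i j‖ ≤ R} =
      Set.univ.pi fun v => {g : LocalGroup v | ∀ i j, ‖g i j‖ ≤ R} := by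
    ext g; simp [Set.mem_pi]
  rw [this]
  exact isCompact_univ_pi h

/-- The homomorphism `SL(2, 𝓞) → SL(2, K)`. -/
def intMatrix : Matrix.SpecialLinearGroup (Fin 2) (𝓞 K) →* Matrix.SpecialLinearGroup (Fin 2) K :=
  Matrix.SpecialLinearGroup.map (algebraMap (𝓞 K) K)

lemma intMatrix_apply (δ : Matrix.SpecialLinearGroup (Fin 2) (𝓞 K)) (i j : Fin 2) :
    intMatrix δ i j = algebraMap (𝓞 K) K (δ i j) := rfl

lemma mem_Gam {g : Grp K} : g ∈ Gam K ↔ ∃ δ, g = diagonalEmbedding K (intMatrix δ) := by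
  simp only [Gam, MonoidHom.mem_range, MonoidHom.comp_apply, intMatrix, eq_comm]

lemma intMatrix_mulVec (δ : Matrix.SpecialLinearGroup (Fin 2) (𝓞 K)) (w : Fin 2 → 𝓞 K) :
    (intMatrix δ).1.mulVec (intVec w) = intVec (δ.1.mulVec w) := by
  funext i
  simp only [Matrix.mulVec, dotProduct, Fin.sum_univ_two, intVec, map_add, map_mul]
  rfl

lemma diagonalEmbedding_apply (γ : Matrix.SpecialLinearGroup (Fin 2) K) (v : InfinitePlace K)
    (i j : Fin 2) : diagonalEmbedding K γ v i j = algebraMap K v.Completion (γ i j) := rfl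

/-- The points of `G / Γ` as cosets of matrices with entries in `𝓞`. -/
lemma proj_eq_iff {g h : Grp K} :
    proj g = proj h ↔ ∃ δ, h = g * diagonalEmbedding K (intMatrix δ) := by
  rw [proj, proj, QuotientGroup.eq, mem_Gam]
  exact exists_congr fun δ => by rw [inv_mul_eq_iff_eq_mul]

lemma smul_proj (g h : Grp K) : g • proj h = proj (g * h) := rfl

lemma continuous_proj : Continuous (proj : Grp K → Space K) := QuotientGroup.continuous_mk

lemma isOpenMap_proj : IsOpenMap (proj : Grp K → Space K) := QuotientGroup.isOpenMap_coe

variable [NumberField K]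

/-- Elements of `𝓞` are separated from each other in `∏_v K_v`: those in a ball of radius
`1 / 2` coincide. -/
lemma int_eq_of_norm_sub_lt {a b : 𝓞 K} {x : ∀ v : InfinitePlace K, v.Completion}
    (ha : ∀ v, ‖algebraMap K v.Completion (a : K) - x v‖ < 1 / 2)
    (hb : ∀ v, ‖algebraMap K v.Completion (b : K) - x v‖ < 1 / 2) : a = b := by
  rw [← sub_eq_zero]
  refine eq_zero_of_norm_lt_one fun v => ?_
  have : algebraMap K v.Completion ((a - b : 𝓞 K) : K) =
      (algebraMap K v.Completion (a : K) - x v) - (algebraMap K v.Completion (b : K) - x v) := by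
    have e : ((a - b : 𝓞 K) : K) = (a : K) - b := map_sub (algebraMap (𝓞 K) K) a b
    rw [e, map_sub]
    ring
  rw [this]
  have := norm_sub_le (algebraMap K v.Completion (a : K) - x v)
    (algebraMap K v.Completion (b : K) - x v)
  linarith [ha v, hb v]

/-- Every `x ∈ G` has a neighbourhood containing at most one element of `Γ`. -/
lemma exists_nhds_Gam_subsingleton (x : Grp K) :
    ∃ U ∈ nhds x, ((Gam K : Set (Grp K)) ∩ U).Subsingleton := by
  refine ⟨{g | ∀ v i j, ‖g v i j - x v i j‖ < 1 / 2}, ?_, ?_⟩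
  · refine Filter.eventually_all.2 fun v => Filter.eventually_all.2 fun i =>
      Filter.eventually_all.2 fun j => ?_
    have hc : Continuous fun g : Grp K => ‖g v i j - x v i j‖ :=
      ((continuous_entry v i j).sub continuous_const).norm
    exact hc.continuousAt.eventually_lt continuousAt_const (by simp)
  · rintro g ⟨hg, hgU⟩ h ⟨hh, hhU⟩
    obtain ⟨δ, rfl⟩ := mem_Gam.1 hg
    obtain ⟨δ', rfl⟩ := mem_Gam.1 hh
    congr 2
    ext i j
    refine congrArg _ (int_eq_of_norm_sub_lt (x := fun v => x v i j)
      (fun v => hgU v i j) (fun v => hhU v i j))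

lemma mem_closure_inter_of_mem_nhds {X : Type*} [TopologicalSpace X] {s U : Set X} {x : X}
    (hx : x ∈ closure s) (hU : U ∈ nhds x) : x ∈ closure (s ∩ U) := by
  rw [mem_closure_iff_nhds] at *
  intro t ht
  obtain ⟨y, ⟨hyt, hyU⟩, hys⟩ := hx (t ∩ U) (Filter.inter_mem ht hU)
  exact ⟨y, hyt, hys, hyU⟩

lemma isClosed_Gam : IsClosed (Gam K : Set (Grp K)) := by
  refine isClosed_of_closure_subset fun x hx => ?_
  -- A point of the closure is already in the closure of a set with at most one element.
  obtain ⟨U, hU, hs⟩ := exists_nhds_Gam_subsingleton x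
  have hx' : x ∈ closure ((Gam K : Set (Grp K)) ∩ U) := mem_closure_inter_of_mem_nhds hx hU
  have := hs.isClosed.closure_eq ▸ hx'
  exact this.1

instance : T2Space (Space K) := by
  rw [t2Space_iff_of_isOpenQuotientMap (π := ((↑) : Grp K → Space K))
    QuotientGroup.isOpenQuotientMap_mk]
  have : {q : Grp K × Grp K | (q.1 : Space K) = q.2} = (fun q => q.1⁻¹ * q.2) ⁻¹' Gam K := by
    ext q
    exact QuotientGroup.eq
  rw [this]
  exact isClosed_Gam.preimage (by fun_prop)

lemma isOpen_entries_lt (R : ℝ) : IsOpen {g : Grp K | ∀ v i j, ‖g v i j‖ < R} := by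
  simp only [Set.ofPred_forall]
  exact isOpen_iInter_of_finite fun v => isOpen_iInter_of_finite fun i =>
    isOpen_iInter_of_finite fun j => isOpen_lt (continuous_entry v i j).norm continuous_const

lemma exists_entries_lt (g : Grp K) : ∃ n : ℕ, ∀ v i j, ‖g v i j‖ < n := by
  obtain ⟨R, hR⟩ := Finite.bddAbove_range fun p : InfinitePlace K × Fin 2 × Fin 2 =>
    ‖g p.1 p.2.1 p.2.2‖
  obtain ⟨n, hn⟩ := exists_nat_gt R
  exact ⟨n, fun v i j => (hR ⟨(v, i, j), rfl⟩).trans_lt hn⟩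

instance : SigmaCompactSpace (Grp K) :=
  SigmaCompactSpace.of_countable (Set.range fun n : ℕ => {g : Grp K | ∀ v i j, ‖g v i j‖ ≤ n})
    (Set.countable_range _) (by rintro _ ⟨n, rfl⟩; exact isCompact_entries_le _)
    (by
      refine Set.eq_univ_of_forall fun g => ?_
      obtain ⟨n, hn⟩ := exists_entries_lt g
      exact ⟨_, ⟨n, rfl⟩, fun v i j => (hn v i j).le⟩)

instance : LocallyCompactSpace (Grp K) := by
  have h : WeaklyLocallyCompactSpace (Grp K) := ⟨fun g => by
    obtain ⟨n, hn⟩ := exists_entries_lt g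
    exact ⟨_, isCompact_entries_le n, Filter.mem_of_superset ((isOpen_entries_lt n).mem_nhds hn)
      fun h hh v i j => (hh v i j).le⟩⟩
  infer_instance

/-- A compact subset of `G / Γ` is the image of a bounded subset of `G`. -/
lemma exists_bounded_lift {C : Set (Space K)} (hC : IsCompact C) :
    ∃ R : ℝ, ∀ x ∈ C, ∃ h : Grp K, proj h = x ∧ ∀ v i j, ‖h v i j‖ ≤ R := by
  obtain ⟨n, hn⟩ := hC.elim_directed_cover
    (fun n : ℕ => (proj : Grp K → Space K) '' {g : Grp K | ∀ v i j, ‖g v i j‖ < n})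
    (fun n => isOpenMap_proj _ (isOpen_entries_lt _))
    (by
      intro x _
      obtain ⟨g, rfl⟩ := QuotientGroup.mk_surjective x
      obtain ⟨n, hn⟩ := exists_entries_lt g
      exact Set.mem_iUnion.2 ⟨n, g, hn, rfl⟩)
    (directed_of_isDirected_le fun m n hmn => Set.image_mono fun g hg v i j =>
      (hg v i j).trans_le (by exact_mod_cast hmn))
  refine ⟨n, fun x hx => ?_⟩
  obtain ⟨h, hh, rfl⟩ := hn hx
  exact ⟨h, rfl, fun v i j => (hh v i j).le⟩

end Gamma

/-! ### Mahler's compactness criterion -/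

section Mahler

variable {K : Type*} [Field K]

/-- A nonzero vector of the plane is moved to the first basis vector by a matrix of `SL(2)` whose
size is controlled by that of the vector. -/
lemma exists_mulVec_eq_basis {F : Type*} [NormedField F] (x : Fin 2 → F) (hx : x ≠ 0) :
    ∃ k : Matrix.SpecialLinearGroup (Fin 2) F, k.1.mulVec x 0 = 1 ∧ k.1.mulVec x 1 = 0 ∧
      ∀ i j, ‖k i j‖ ≤ ‖x‖ + ‖x‖⁻¹ := by
  have h0 := norm_le_pi_norm x 0
  have h1 := norm_le_pi_norm x 1
  have hpos : 0 < ‖x‖ := norm_pos_iff.2 hx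
  have hinv : 0 < ‖x‖⁻¹ := inv_pos.2 hpos
  rcases le_total ‖x 1‖ ‖x 0‖ with h | h
  · have hn : ‖x‖ = ‖x 0‖ := le_antisymm
      ((pi_norm_le_iff_of_nonneg (norm_nonneg _)).2 (by simp [Fin.forall_fin_two, h])) h0
    have hx0 : x 0 ≠ 0 := fun h' => by simp [hn, h'] at hpos
    refine ⟨⟨!![(x 0)⁻¹, 0; -x 1, x 0], by simp [Matrix.det_fin_two, hx0]⟩, ?_, ?_, ?_⟩
    · simp [Matrix.mulVec, dotProduct, Fin.sum_univ_two, hx0]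
    · simp [Matrix.mulVec, dotProduct, Fin.sum_univ_two]
      ring
    · intro i j
      fin_cases i <;> fin_cases j <;> simp <;> first | rw [← hn]; linarith | linarith
  · have hn : ‖x‖ = ‖x 1‖ := le_antisymm
      ((pi_norm_le_iff_of_nonneg (norm_nonneg _)).2 (by simp [Fin.forall_fin_two, h])) h1
    have hx1 : x 1 ≠ 0 := fun h' => by simp [hn, h'] at hpos
    refine ⟨⟨!![0, (x 1)⁻¹; -x 1, x 0], by simp [Matrix.det_fin_two, hx1]⟩, ?_, ?_, ?_⟩
    · simp [Matrix.mulVec, dotProduct, Fin.sum_univ_two, hx1]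
    · simp [Matrix.mulVec, dotProduct, Fin.sum_univ_two]
      ring
    · intro i j
      fin_cases i <;> fin_cases j <;> simp <;> first | rw [← hn]; linarith | linarith

lemma exists_eq_smul_of_det_eq_zero {F : Type*} [Field F] {x y : Fin 2 → F} (hx : x ≠ 0)
    (h : x 0 * y 1 = x 1 * y 0) : ∃ a : F, y = a • x := by
  by_cases h0 : x 0 = 0
  · have h1 : x 1 ≠ 0 := fun h1 => hx (funext fun i => by fin_cases i <;> simp [h0, h1])
    have hy : y 0 = 0 := by simpa [h0, h1] using h.symm
    exact ⟨y 1 / x 1, funext fun i => by fin_cases i <;> simp [h0, h1, hy]⟩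
  · refine ⟨y 0 / x 0, funext fun i => ?_⟩
    fin_cases i
    · simp [h0]
    · simp only [Fin.mk_one, Pi.smul_apply, smul_eq_mul]
      field_simp
      linear_combination h

lemma evalVec_flow_mul_zero (c : InfinitePlace K → ℝ) (g : Grp K) (w : Fin 2 → K)
    (v : InfinitePlace K) :
    evalVec (flow c * g) w v 0 = realEmbedding v (Real.exp (c v)) * evalVec g w v 0 := by
  rw [evalVec_mul]
  simp [Matrix.mulVec, dotProduct, Fin.sum_univ_two, flow, boost]

lemma evalVec_flow_mul_one (c : InfinitePlace K → ℝ) (g : Grp K) (w : Fin 2 → K)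
    (v : InfinitePlace K) :
    evalVec (flow c * g) w v 1 = realEmbedding v (Real.exp (-c v)) * evalVec g w v 1 := by
  rw [evalVec_mul]
  simp [Matrix.mulVec, dotProduct, Fin.sum_univ_two, flow, boost]

lemma norm_evalVec_flow_mul_zero (c : InfinitePlace K → ℝ) (g : Grp K) (w : Fin 2 → K)
    (v : InfinitePlace K) :
    ‖evalVec (flow c * g) w v 0‖ = Real.exp (c v) * ‖evalVec g w v 0‖ := by
  rw [evalVec_flow_mul_zero, norm_mul, norm_realEmbedding, Real.abs_exp]

lemma norm_evalVec_flow_mul_one (c : InfinitePlace K → ℝ) (g : Grp K) (w : Fin 2 → K)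
    (v : InfinitePlace K) :
    ‖evalVec (flow c * g) w v 1‖ = Real.exp (-c v) * ‖evalVec g w v 1‖ := by
  rw [evalVec_flow_mul_one, norm_mul, norm_realEmbedding, Real.abs_exp]

variable [NumberField K]

lemma sum_mult_ne_zero : ∑ v : InfinitePlace K, v.mult ≠ 0 := by
  obtain ⟨v⟩ : Nonempty (InfinitePlace K) := inferInstance
  intro h
  exact v.mult_ne_zero (Finset.sum_eq_zero_iff.1 h v (Finset.mem_univ v))

/-- A single component is bounded below by the height, the others being bounded. -/
lemma height_le_norm_mul {g : Grp K} {w : Fin 2 → K} {C : ℝ} (hC : 1 ≤ C)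
    (h : ∀ v, ‖evalVec g w v‖ ≤ C) (v : InfinitePlace K) :
    height g w ≤ ‖evalVec g w v‖ * ∏ u : InfinitePlace K, C ^ u.mult := by
  classical
  rw [height, ← Finset.mul_prod_erase _ _ (Finset.mem_univ v),
    ← Finset.mul_prod_erase _ (fun u : InfinitePlace K => C ^ u.mult) (Finset.mem_univ v),
    ← mul_assoc]
  refine mul_le_mul ?_ (Finset.prod_le_prod (fun u _ => by positivity)
    fun u _ => pow_le_pow_left₀ (norm_nonneg _) (h u) _)
    (Finset.prod_nonneg fun u _ => by positivity) (by positivity)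
  obtain ⟨n, hn⟩ := Nat.exists_eq_succ_of_ne_zero v.mult_ne_zero
  rw [hn, pow_succ', pow_succ']
  refine mul_le_mul_of_nonneg_left ?_ (norm_nonneg _)
  exact (pow_le_pow_left₀ (norm_nonneg _) (h v) n).trans
    (le_mul_of_one_le_left (by positivity) hC)

variable (K) in
/-- If no nonzero vector of `g 𝓞²` is small then `𝓞²` contains two independent vectors whose
images under `g` are bounded. The second one comes from Minkowski's theorem for a box that is
narrow in the direction of the first one. -/
theorem exists_independent_short_vectors {ε : ℝ} (hε : 0 < ε) : ∃ C : ℝ, 0 < C ∧ ∀ g : Grp K,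
    (∀ w : Fin 2 → 𝓞 K, w ≠ 0 → ε ≤ height g (intVec w)) →
    ∃ w₁ w₂ : Fin 2 → 𝓞 K, w₁ 0 * w₂ 1 - w₁ 1 * w₂ 0 ≠ 0 ∧
      ∀ v, ‖evalVec g (intVec w₁) v‖ ≤ C ∧ ‖evalVec g (intVec w₂) v‖ ≤ C := by
  obtain ⟨C₀, -, hC₀⟩ := exists_short_vector K
  set C := max C₀ 1
  have hC1 : 1 ≤ C := le_max_right _ _
  have hCpos : 0 < C := by positivity
  have hC (g : Grp K) : ∃ w : Fin 2 → 𝓞 K, w ≠ 0 ∧ ∀ v, ‖evalVec g (intVec w) v‖ ≤ C := by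
    obtain ⟨w, hw0, hw⟩ := hC₀ g
    exact ⟨w, hw0, fun v => (pi_norm_le_iff_of_nonneg hCpos.le).2
      fun i => (hw v i).trans (le_max_left _ _)⟩
  set D := ∏ u : InfinitePlace K, C ^ u.mult
  have hD : 0 < D := Finset.prod_pos fun u _ => by positivity
  -- If `w₂` were proportional to `w₁`, its height would be less than `ε` by the choice of `t`.
  set t := D / ε + 1
  have ht : 1 ≤ t := by
    have : 0 < D / ε := by positivity
    linarith
  set B := C + D / ε
  have hB : 0 < B := by positivity
  refine ⟨C + 2 * B * (C * t * C), by positivity, fun g hg => ?_⟩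
  obtain ⟨w₁, hw₁0, hw₁⟩ := hC g
  have hlow (v) : ‖evalVec g (intVec w₁) v‖⁻¹ ≤ D / ε := by
    have h1 := (hg w₁ hw₁0).trans (height_le_norm_mul hC1 hw₁ v)
    have h2 := norm_pos_iff.2 (evalVec_ne_zero g (intVec_ne_zero hw₁0) v)
    rw [inv_le_iff_one_le_mul₀ h2, div_mul_eq_mul_div, one_le_div hε]
    linarith
  -- In the coordinates given by `k` the vector `g w₁` is the first basis vector; the flow by `σ`
  -- stretches this direction, so that Minkowski's theorem applies to a narrow box.
  choose k hk0 hk1 hk using fun v =>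
    exists_mulVec_eq_basis _ (evalVec_ne_zero g (intVec_ne_zero hw₁0) v)
  have hkB (v i j) : ‖k v i j‖ ≤ B := (hk v i j).trans (add_le_add (hw₁ v) (hlow v))
  set σ := Real.log (C * t)
  have hσ : Real.exp σ = C * t := Real.exp_log (by positivity)
  obtain ⟨w₂, hw₂0, hw₂⟩ := hC (flow (fun _ => σ) * (k * g))
  refine ⟨w₁, w₂, fun hdet => ?_, fun v => ⟨(hw₁ v).trans ?_, ?_⟩⟩
  · obtain ⟨a, ha⟩ := exists_eq_smul_of_det_eq_zero (y := intVec w₂) (intVec_ne_zero hw₁0) (by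
      simp only [intVec, ← map_mul]
      rw [sub_eq_zero.1 hdet])
    have hv (v : InfinitePlace K) : ‖algebraMap K v.Completion a‖ ≤ t⁻¹ := by
      have h1 := (norm_le_pi_norm _ 0).trans (hw₂ v)
      rw [norm_evalVec_flow_mul_zero, ha, evalVec_smul, evalVec_mul, hσ, Pi.smul_apply, hk0,
        smul_eq_mul, mul_one] at h1
      rw [← one_div, le_div_iff₀' (by positivity)]
      rw [mul_assoc] at h1
      exact (mul_le_iff_le_one_right hCpos).1 h1
    have h1 := hg w₂ hw₂0
    rw [ha, height_smul, ← prod_norm_algebraMap] at h1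
    have h2 : ∏ v : InfinitePlace K, ‖algebraMap K v.Completion a‖ ^ v.mult ≤ t⁻¹ :=
      calc _ ≤ ∏ v : InfinitePlace K, t⁻¹ ^ v.mult :=
            Finset.prod_le_prod (fun v _ => by positivity)
              fun v _ => pow_le_pow_left₀ (norm_nonneg _) (hv v) _
        _ = t⁻¹ ^ ∑ v : InfinitePlace K, v.mult := Finset.prod_pow_eq_pow_sum _ _ _
        _ ≤ t⁻¹ := pow_le_of_le_one (by positivity) (inv_le_one_of_one_le₀ ht) sum_mult_ne_zero
    have h3 : height g (intVec w₁) ≤ D :=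
      Finset.prod_le_prod (fun v _ => by positivity)
        fun v _ => pow_le_pow_left₀ (norm_nonneg _) (hw₁ v) _
    have h4 : ε ≤ t⁻¹ * D := h1.trans (mul_le_mul h2 h3 (height_nonneg _ _) (by positivity))
    have h5 : ε * t ≤ D := by
      rwa [inv_mul_eq_div, le_div_iff₀ (by positivity)] at h4
    have h6 : ε * t = D + ε := by simp only [t]; field_simp
    linarith
  · have : 0 < 2 * B * (C * t * C) := by positivity
    linarith
  · have hct : 1 ≤ C * t := one_le_mul_of_one_le_of_one_le hC1 ht
    have h1 : ‖evalVec (k * g) (intVec w₂) v‖ ≤ C * t * C := by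
      refine (pi_norm_le_iff_of_nonneg (by positivity)).2 fun i => ?_
      fin_cases i
      · have h1 := (norm_le_pi_norm _ 0).trans (hw₂ v)
        rw [norm_evalVec_flow_mul_zero, hσ] at h1
        calc ‖evalVec (k * g) (intVec w₂) v 0‖ ≤ C * t * ‖evalVec (k * g) (intVec w₂) v 0‖ :=
              le_mul_of_one_le_left (norm_nonneg _) hct
          _ ≤ C := h1
          _ ≤ C * t * C := le_mul_of_one_le_left hCpos.le hct
      · have h1 := (norm_le_pi_norm _ 1).trans (hw₂ v)
        rw [norm_evalVec_flow_mul_one, Real.exp_neg, hσ, inv_mul_le_iff₀ (by positivity)] at h1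
        exact h1
    rw [evalVec_mul] at h1
    have h2 := norm_le_norm_mulVec (hkB v) (evalVec g (intVec w₂) v)
    have h3 : 2 * B * ‖(k v).1.mulVec (evalVec g (intVec w₂) v)‖ ≤ 2 * B * (C * t * C) :=
      mul_le_mul_of_nonneg_left h1 (by positivity)
    linarith

lemma finite_setOf_norm_le (B : ℝ) :
    {a : 𝓞 K | ∀ v : InfinitePlace K, ‖algebraMap K v.Completion (a : K)‖ ≤ B}.Finite := by
  refine ((Embeddings.finite_of_norm_le K ℂ B).preimage
    (f := fun a : 𝓞 K => (a : K)) RingOfIntegers.coe_injective.injOn).subset fun a ha => ?_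
  refine ⟨a.isIntegral_coe, (InfinitePlace.le_iff_le _ _).1 fun v => ?_⟩
  rw [← norm_algebraMap]
  exact ha v

/-- There are finitely many classes of integral matrices of given nonzero determinant modulo
left multiplication by `SL(2, 𝓞)`. -/
lemma exists_finite_representatives {F : Set (𝓞 K)} (hF : F.Finite) :
    ∃ S : Set (Matrix (Fin 2) (Fin 2) (𝓞 K)), S.Finite ∧ (∀ W ∈ S, W.det ≠ 0) ∧
      ∀ W : Matrix (Fin 2) (Fin 2) (𝓞 K), W.det ≠ 0 → W.det ∈ F →
        ∃ W' ∈ S, ∃ δ : Matrix.SpecialLinearGroup (Fin 2) (𝓞 K), W = δ.1 * W' := by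
  classical
  -- Matrices with the same determinant in `F` that are congruent modulo `m` are in the same class.
  set m : 𝓞 K := ∏ a ∈ hF.toFinset.erase 0, a
  have hm : m ≠ 0 := Finset.prod_ne_zero_iff.2 fun a ha => Finset.ne_of_mem_erase ha
  have : Finite (𝓞 K ⧸ Ideal.span {m}) :=
    Ideal.finiteQuotientOfFreeOfNeBot _ (by simpa using hm)
  set T := {W : Matrix (Fin 2) (Fin 2) (𝓞 K) | W.det ≠ 0 ∧ W.det ∈ F}
  let f : Matrix (Fin 2) (Fin 2) (𝓞 K) → 𝓞 K × Matrix (Fin 2) (Fin 2) (𝓞 K ⧸ Ideal.span {m}) :=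
    fun W => (W.det, W.map (Ideal.Quotient.mk _))
  have hfT : (f '' T).Finite := by
    refine (hF.prod (Set.finite_univ)).subset ?_
    rintro _ ⟨W, hW, rfl⟩
    exact ⟨hW.2, trivial⟩
  refine ⟨Function.invFunOn f T '' (f '' T), hfT.image _, ?_, fun W h0 hWF => ?_⟩
  · rintro _ ⟨_, hc, rfl⟩
    exact (Function.invFunOn_mem hc).1
  · have hc : f W ∈ f '' T := ⟨W, ⟨h0, hWF⟩, rfl⟩
    set W' := Function.invFunOn f T (f W)
    have hW' : f W' = f W := Function.invFunOn_eq hc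
    refine ⟨W', ⟨_, hc, rfl⟩, ?_⟩
    have hdet : W'.det = W.det := congrArg Prod.fst hW'
    have hdvd (i j) : W.det ∣ W i j - W' i j := by
      have h1 : Ideal.Quotient.mk (Ideal.span {m}) (W i j) = Ideal.Quotient.mk _ (W' i j) :=
        congrFun (congrFun (congrArg Prod.snd hW').symm i) j
      rw [Ideal.Quotient.eq, Ideal.mem_span_singleton] at h1
      exact (Finset.dvd_prod_of_mem _ (Finset.mem_erase.2 ⟨h0, hF.mem_toFinset.2 hWF⟩)).trans h1
    choose q hq using hdvd
    -- `W adj(W') / det W` is integral since `W ≡ W'` modulo `det W = det W'`.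
    have hq' : W = W' + W.det • Matrix.of q := by
      ext i j
      simp [← hq]
    set δ : Matrix (Fin 2) (Fin 2) (𝓞 K) := 1 + Matrix.of q * W'.adjugate
    have hδ : δ * W' = W := by
      rw [add_mul, one_mul, mul_assoc, Matrix.adjugate_mul, hdet, Matrix.mul_smul, mul_one]
      exact hq'.symm
    refine ⟨⟨δ, ?_⟩, hδ.symm⟩
    have := congrArg Matrix.det hδ
    rw [Matrix.det_mul, hdet] at this
    exact mul_right_cancel₀ h0 (this.trans (one_mul _).symm)

variable (K) in
/-- Mahler's compactness criterion for `G / Γ`: if no nonzero vector of `g 𝓞²` is small then `g`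
is bounded modulo `Γ`. -/
theorem exists_bounded_mul_of_le_height {ε : ℝ} (hε : 0 < ε) : ∃ R : ℝ, ∀ g : Grp K,
    (∀ w : Fin 2 → 𝓞 K, w ≠ 0 → ε ≤ height g (intVec w)) →
    ∃ δ : Matrix.SpecialLinearGroup (Fin 2) (𝓞 K),
      ∀ v i j, ‖(g * diagonalEmbedding K (intMatrix δ)) v i j‖ ≤ R := by
  -- Two independent short vectors are the columns of an integral matrix of bounded determinant,
  -- which is `δ W'` with `W'` in a finite set. Then `g δ` is bounded because `g δ W'` is.
  obtain ⟨C, hC, h⟩ := exists_independent_short_vectors K hε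
  obtain ⟨S, hS, hS0, hSr⟩ :=
    exists_finite_representatives (finite_setOf_norm_le (K := K) (2 * C * C))
  obtain ⟨A, hA⟩ : ∃ A : ℝ, ∀ W ∈ S, ∀ (v : InfinitePlace K) (i j : Fin 2),
      ‖algebraMap K v.Completion (W i j : K)‖ ≤ A * ‖algebraMap K v.Completion (W.det : K)‖ := by
    obtain ⟨A, hA⟩ := ((hS.prod (Set.finite_univ (α := InfinitePlace K × Fin 2 × Fin 2))).image
      fun p : Matrix (Fin 2) (Fin 2) (𝓞 K) × InfinitePlace K × Fin 2 × Fin 2 =>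
        ‖algebraMap K p.2.1.Completion (p.1 p.2.2.1 p.2.2.2 : K)‖ /
        ‖algebraMap K p.2.1.Completion (p.1.det : K)‖).bddAbove
    refine ⟨A, fun W hW v i j => ?_⟩
    rw [← div_le_iff₀ (norm_pos_iff.2 ((map_ne_zero _).2 (by simpa using hS0 W hW)))]
    exact hA ⟨(W, v, i, j), ⟨hW, trivial⟩, rfl⟩
  refine ⟨2 * C * A, fun g hg => ?_⟩
  obtain ⟨w₁, w₂, hdet, hw⟩ := h g hg
  set W : Matrix (Fin 2) (Fin 2) (𝓞 K) := !![w₁ 0, w₂ 0; w₁ 1, w₂ 1]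
  have hWdet : W.det = w₁ 0 * w₂ 1 - w₁ 1 * w₂ 0 := by
    rw [Matrix.det_fin_two]; simp [W]; ring
  have hg1 (v i) : ‖evalVec g (intVec w₁) v i‖ ≤ C := (norm_le_pi_norm _ i).trans (hw v).1
  have hg2 (v i) : ‖evalVec g (intVec w₂) v i‖ ≤ C := (norm_le_pi_norm _ i).trans (hw v).2
  obtain ⟨W', hW'S, δ, hδ⟩ := hSr W (by rwa [hWdet]) (by
    intro v
    have : algebraMap K v.Completion (W.det : K) =
        evalVec g (intVec w₁) v 0 * evalVec g (intVec w₂) v 1 -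
        evalVec g (intVec w₁) v 1 * evalVec g (intVec w₂) v 0 := by
      rw [hWdet]
      have e : ((w₁ 0 * w₂ 1 - w₁ 1 * w₂ 0 : 𝓞 K) : K) =
        intVec w₁ 0 * intVec w₂ 1 - intVec w₁ 1 * intVec w₂ 0 := by simp [intVec]
      simp only [evalVec_apply, e, map_sub, map_mul]
      linear_combination (- (algebraMap K v.Completion (intVec w₁ 0) *
        algebraMap K v.Completion (intVec w₂ 1) - algebraMap K v.Completion (intVec w₁ 1) *
        algebraMap K v.Completion (intVec w₂ 0))) * det_eq_one (g v)
    rw [this]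
    refine (norm_sub_le _ _).trans ?_
    rw [norm_mul, norm_mul]
    have h1 := mul_le_mul (hg1 v 0) (hg2 v 1) (norm_nonneg _) hC.le
    have h2 := mul_le_mul (hg1 v 1) (hg2 v 0) (norm_nonneg _) hC.le
    linarith)
  refine ⟨δ, fun v i j => ?_⟩
  have hcol1 : intVec w₁ = (intMatrix δ).1.mulVec (intVec fun j => W' j 0) := by
    rw [intMatrix_mulVec]
    congr 1
    funext i
    have := congrFun (congrFun hδ i) 0
    fin_cases i <;> exact this
  have hcol2 : intVec w₂ = (intMatrix δ).1.mulVec (intVec fun j => W' j 1) := by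
    rw [intMatrix_mulVec]
    congr 1
    funext i
    have := congrFun (congrFun hδ i) 1
    fin_cases i <;> exact this
  have e1 := hg1 v i
  have e2 := hg2 v i
  rw [hcol1, ← evalVec_mul_diagonalEmbedding, evalVec_apply] at e1
  rw [hcol2, ← evalVec_mul_diagonalEmbedding, evalVec_apply] at e2
  set x := (g * diagonalEmbedding K (intMatrix δ)) v
  set a := algebraMap K v.Completion (intVec (fun j => W' j 0) 0)
  set b := algebraMap K v.Completion (intVec (fun j => W' j 1) 0)
  set c := algebraMap K v.Completion (intVec (fun j => W' j 0) 1)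
  set d := algebraMap K v.Completion (intVec (fun j => W' j 1) 1)
  have hdet' : algebraMap K v.Completion (W'.det : K) = a * d - b * c := by
    have e : ((W'.det : 𝓞 K) : K) = W' 0 0 * W' 1 1 - W' 0 1 * W' 1 0 := by
      rw [Matrix.det_fin_two]; simp
    rw [e, map_sub, map_mul, map_mul]
    rfl
  have hpos : 0 < ‖a * d - b * c‖ := by
    rw [← hdet', norm_pos_iff, map_ne_zero]
    simpa using hS0 W' hW'S
  have ha := hA W' hW'S v 0 0
  have hb := hA W' hW'S v 0 1
  have hc := hA W' hW'S v 1 0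
  have hd := hA W' hW'S v 1 1
  rw [hdet'] at ha hb hc hd
  refine le_of_mul_le_mul_right ?_ hpos
  rw [← norm_mul]
  have bound {p q r s : v.Completion} (hp : ‖p‖ ≤ C) (hq : ‖q‖ ≤ C)
      (hr : ‖r‖ ≤ A * ‖a * d - b * c‖) (hs : ‖s‖ ≤ A * ‖a * d - b * c‖) :
      ‖p * r - q * s‖ ≤ 2 * C * A * ‖a * d - b * c‖ := by
    refine (norm_sub_le _ _).trans ?_
    rw [norm_mul, norm_mul]
    have h1 := mul_le_mul hp hr (norm_nonneg _) hC.le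
    have h2 := mul_le_mul hq hs (norm_nonneg _) hC.le
    linarith
  fin_cases j
  · refine le_trans (le_of_eq ?_) (bound e1 e2 hd hc)
    congr 1
    change x i 0 * _ = (x i 0 * a + x i 1 * c) * d - (x i 0 * b + x i 1 * d) * c
    ring
  · refine le_trans (le_of_eq ?_) (bound e2 e1 ha hb)
    congr 1
    change x i 1 * _ = (x i 0 * b + x i 1 * d) * a - (x i 0 * a + x i 1 * c) * b
    ring

end Mahler

/-! ### Rational lines -/

section Lines

variable {K : Type*} [Field K]

lemma mul_diagonalEmbedding_apply (g : Grp K) (γ : Matrix.SpecialLinearGroup (Fin 2) K)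
    (v : InfinitePlace K) (i j : Fin 2) :
    (g * diagonalEmbedding K γ) v i j = evalVec g (fun k => γ k j) v i := by
  rw [evalVec_apply]
  simp only [Pi.mul_apply, Matrix.SpecialLinearGroup.coe_mul, Matrix.mul_apply, Fin.sum_univ_two,
    diagonalEmbedding_apply]

/-- If `g_v` maps two rational lines to the coordinate axes then it is the product of a diagonal
and a rational matrix. -/
lemma exists_diagonal_of_lines {g : Grp K} {v : InfinitePlace K} {w w' : Fin 2 → 𝓞 K}
    (hw : w ≠ 0) (hw' : w' ≠ 0) (h : evalVec g (intVec w) v 0 = 0)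
    (h' : evalVec g (intVec w') v 1 = 0) :
    ∃ γ, (g * diagonalEmbedding K γ) v 0 1 = 0 ∧ (g * diagonalEmbedding K γ) v 1 0 = 0 := by
  set x := intVec w
  set y := intVec w'
  have hx1 : evalVec g x v 1 ≠ 0 := fun h1 => evalVec_ne_zero g (intVec_ne_zero hw) v
    (funext fun i => by fin_cases i <;> simp [x, h, h1])
  have hy0 : evalVec g y v 0 ≠ 0 := fun h1 => evalVec_ne_zero g (intVec_ne_zero hw') v
    (funext fun i => by fin_cases i <;> simp [y, h', h1])
  have hdet : y 0 * x 1 - y 1 * x 0 ≠ 0 := by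
    intro h0
    apply mul_ne_zero hy0 hx1
    have e := congrArg (algebraMap K v.Completion) h0
    simp only [map_sub, map_mul, map_zero] at e
    rw [evalVec_apply] at h h' ⊢
    rw [evalVec_apply]
    linear_combination e * (g v 0 0 * g v 1 1 - g v 0 1 * g v 1 0) + (g v 1 0 *
      algebraMap K v.Completion (y 0) + g v 1 1 * algebraMap K v.Completion (y 1)) * h
  set Δ := y 0 * x 1 - y 1 * x 0
  obtain ⟨γ, h0, h1⟩ : ∃ γ : Matrix.SpecialLinearGroup (Fin 2) K,
      (fun k => γ k 0) = y ∧ (fun k => γ k 1) = Δ⁻¹ • x := by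
    refine ⟨⟨!![y 0, Δ⁻¹ * x 0; y 1, Δ⁻¹ * x 1], ?_⟩, ?_, ?_⟩
    · rw [Matrix.det_fin_two]
      simp only [Matrix.of_apply, Matrix.cons_val', Matrix.cons_val_zero, Matrix.cons_val_one,
        Matrix.cons_val_fin_one]
      rw [← inv_mul_cancel₀ hdet]
      simp only [Δ]
      ring
    · funext k; fin_cases k <;> rfl
    · funext k; fin_cases k <;> rfl
  refine ⟨γ, ?_, ?_⟩
  · rw [mul_diagonalEmbedding_apply, h1, evalVec_smul, Pi.smul_apply, h, smul_zero]
  · rw [mul_diagonalEmbedding_apply, h0, h']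

variable [NumberField K]

lemma exists_intVec_eq_smul (x : Fin 2 → K) :
    ∃ a : K, a ≠ 0 ∧ ∃ w : Fin 2 → 𝓞 K, intVec w = a • x := by
  obtain ⟨b, hb⟩ := IsLocalization.exist_integer_multiples_of_finite (nonZeroDivisors (𝓞 K)) x
  choose w hw using hb
  refine ⟨(b : 𝓞 K), by simp, w, funext fun j => ?_⟩
  rw [intVec, hw, Algebra.smul_def]
  rfl

lemma col_ne_zero {F : Type*} [Field F] (γ : Matrix.SpecialLinearGroup (Fin 2) F) (j : Fin 2) :
    (fun k => γ k j) ≠ 0 := by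
  intro h
  have h0 := congrFun h 0
  have h1 := congrFun h 1
  have := det_eq_one γ
  simp only [Pi.zero_apply] at h0 h1
  fin_cases j <;> simp_all

lemma exists_intVec_of_evalVec_eq_zero {g : Grp K} {x : Fin 2 → K} (hx : x ≠ 0)
    {v : InfinitePlace K} {i : Fin 2} (h : evalVec g x v i = 0) :
    ∃ w : Fin 2 → 𝓞 K, w ≠ 0 ∧ evalVec g (intVec w) v i = 0 := by
  obtain ⟨a, ha, w, hw⟩ := exists_intVec_eq_smul x
  refine ⟨w, ?_, by rw [hw, evalVec_smul, Pi.smul_apply, h, smul_zero]⟩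
  rintro rfl
  apply smul_ne_zero ha hx
  rw [← hw]
  funext j
  simp [intVec]

/-- The columns of a rational matrix `γ` with `g_v γ` monomial span the two lines that `g_v` maps to
the coordinate axes. -/
lemma exists_lines_of_isMonomial {g : Grp K} {v : InfinitePlace K}
    {γ : Matrix.SpecialLinearGroup (Fin 2) K} (h : IsMonomial ((g * diagonalEmbedding K γ) v)) :
    (∃ w : Fin 2 → 𝓞 K, w ≠ 0 ∧ evalVec g (intVec w) v 0 = 0) ∧
      ∃ w : Fin 2 → 𝓞 K, w ≠ 0 ∧ evalVec g (intVec w) v 1 = 0 := by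
  rcases h.cases with ⟨h0, h1⟩ | ⟨h0, h1⟩ <;> rw [mul_diagonalEmbedding_apply] at h0 h1 <;>
    exact ⟨exists_intVec_of_evalVec_eq_zero (col_ne_zero γ _) h0,
      exists_intVec_of_evalVec_eq_zero (col_ne_zero γ _) h1⟩

end Lines

/-! ### Divergent orbits -/

section Divergence

variable {K : Type*} [Field K]

variable (K) in
/-- The element of `G` interchanging, up to sign, the two coordinates at all places. -/
def weyl : Grp K := fun _ => ⟨!![0, 1; -1, 0], by simp [Matrix.det_fin_two]⟩

lemma single_smul_flow [DecidableEq (InfinitePlace K)] (v : InfinitePlace K) (s : ℝ) :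
    Pi.single v s = s • (Pi.single v 1 : InfinitePlace K → ℝ) := by
  rw [← Pi.single_smul, smul_eq_mul, mul_one]

lemma weyl_mul_flow (c : InfinitePlace K → ℝ) : weyl K * flow c = flow (-c) * weyl K := by
  refine funext fun v => Matrix.SpecialLinearGroup.ext _ _ fun i j => ?_
  simp only [Pi.mul_apply, Matrix.SpecialLinearGroup.coe_mul]
  fin_cases i <;> fin_cases j <;>
    simp [weyl, flow, boost, Matrix.mul_apply, Fin.sum_univ_two]

lemma evalVec_weyl_mul_zero (g : Grp K) (w : Fin 2 → K) (v : InfinitePlace K) :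
    evalVec (weyl K * g) w v 0 = evalVec g w v 1 := by
  rw [evalVec_mul]
  simp [weyl, Matrix.mulVec, dotProduct, Fin.sum_univ_two]

lemma evalVec_weyl_mul_one (g : Grp K) (w : Fin 2 → K) (v : InfinitePlace K) :
    evalVec (weyl K * g) w v 1 = -evalVec g w v 0 := by
  rw [evalVec_mul]
  simp [weyl, Matrix.mulVec, dotProduct, Fin.sum_univ_two]

variable [NumberField K]

/-- Two vectors of `𝓞²` whose images under `g` are both small are proportional. -/
lemma det_eq_zero_of_height_lt {g : Grp K} {w w' : Fin 2 → 𝓞 K}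
    (h : height g (intVec w) < (∏ v : InfinitePlace K, (2 : ℝ) ^ v.mult)⁻¹)
    (h' : height g (intVec w') < (∏ v : InfinitePlace K, (2 : ℝ) ^ v.mult)⁻¹) :
    w 0 * w' 1 - w 1 * w' 0 = 0 := by
  by_contra hdet
  set P := ∏ v : InfinitePlace K, (2 : ℝ) ^ v.mult
  have hP : 1 ≤ P := by
    simp only [P]
    rw [Finset.prod_pow_eq_pow_sum]
    exact one_le_pow₀ one_le_two
  have h1 := one_le_prod_norm hdet
  have h2 : ∏ v : InfinitePlace K, ‖algebraMap K v.Completion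
      ((w 0 * w' 1 - w 1 * w' 0 : 𝓞 K) : K)‖ ^ v.mult ≤
      P * (height g (intVec w) * height g (intVec w')) := by
    simp only [P, height]
    rw [← Finset.prod_mul_distrib, ← Finset.prod_mul_distrib]
    refine Finset.prod_le_prod (fun v _ => by positivity) fun v _ => ?_
    rw [← mul_pow, ← mul_pow]
    refine pow_le_pow_left₀ (norm_nonneg _) ?_ _
    have e : ((w 0 * w' 1 - w 1 * w' 0 : 𝓞 K) : K) =
        intVec w 0 * intVec w' 1 - intVec w 1 * intVec w' 0 := by simp [intVec]
    have : algebraMap K v.Completion ((w 0 * w' 1 - w 1 * w' 0 : 𝓞 K) : K) =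
        evalVec g (intVec w) v 0 * evalVec g (intVec w') v 1 -
        evalVec g (intVec w) v 1 * evalVec g (intVec w') v 0 := by
      simp only [evalVec_apply, e, map_sub, map_mul]
      linear_combination (- (algebraMap K v.Completion (intVec w 0) *
        algebraMap K v.Completion (intVec w' 1) - algebraMap K v.Completion (intVec w 1) *
        algebraMap K v.Completion (intVec w' 0))) * det_eq_one (g v)
    rw [this]
    refine (norm_sub_le _ _).trans ?_
    rw [norm_mul, norm_mul]
    have h1 := mul_le_mul (norm_le_pi_norm (evalVec g (intVec w) v) 0)
      (norm_le_pi_norm (evalVec g (intVec w') v) 1) (norm_nonneg _) (norm_nonneg _)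
    have h2 := mul_le_mul (norm_le_pi_norm (evalVec g (intVec w) v) 1)
      (norm_le_pi_norm (evalVec g (intVec w') v) 0) (norm_nonneg _) (norm_nonneg _)
    linarith
  have h3 : height g (intVec w) * height g (intVec w') < P⁻¹ * P⁻¹ :=
    mul_lt_mul'' h h' (height_nonneg _ _) (height_nonneg _ _)
  have h4 : P * (P⁻¹ * P⁻¹) ≤ 1 := by
    rw [mul_inv_cancel_left₀ (by positivity)]
    exact inv_le_one_of_one_le₀ hP
  have h5 : P * (height g (intVec w) * height g (intVec w')) < P * (P⁻¹ * P⁻¹) :=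
    mul_lt_mul_of_pos_left h3 (by positivity)
  linarith

lemma continuous_height {X : Type*} [TopologicalSpace X] {f : X → Grp K} (hf : Continuous f)
    (w : Fin 2 → K) : Continuous fun x => height (f x) w := by
  refine continuous_finsetProd _ fun v _ => (Continuous.norm ?_).pow _
  refine continuous_pi fun i => ?_
  simp only [evalVec_apply]
  exact (((continuous_entry v i 0).comp hf).mul continuous_const).add
    (((continuous_entry v i 1).comp hf).mul continuous_const)

/-- If all far enough points of the ray `s ↦ diag(e^s, e^{-s}) g` at `v` have a short vector, then
`g_v` maps a rational line to the axis contracted by the ray: as lines with short vectors are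
unique, by connectedness the short vectors all lie on one line. -/
lemma exists_line_of_ray [DecidableEq (InfinitePlace K)] {g : Grp K} {v : InfinitePlace K} {s₀ : ℝ}
    (h : ∀ s ≥ s₀, ∃ w : Fin 2 → 𝓞 K, w ≠ 0 ∧ height (flow (Pi.single v s) * g) (intVec w) <
      (∏ v : InfinitePlace K, (2 : ℝ) ^ v.mult)⁻¹) :
    ∃ w : Fin 2 → 𝓞 K, w ≠ 0 ∧ evalVec g (intVec w) v 0 = 0 := by
  set ε := (∏ v : InfinitePlace K, (2 : ℝ) ^ v.mult)⁻¹
  obtain ⟨w₀, hw₀, hs₀⟩ := h s₀ le_rfl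
  refine ⟨w₀, hw₀, ?_⟩
  by_contra hne
  have hcont (w : Fin 2 → 𝓞 K) :
      Continuous fun s : ℝ => height (flow (Pi.single v s) * g) (intVec w) := by
    refine continuous_height ?_ _
    refine Continuous.mul ?_ continuous_const
    have e : (fun s => flow (Pi.single v s)) = fun s : ℝ => flow (s • Pi.single v (1 : ℝ)) :=
      funext fun s => by rw [single_smul_flow v s]
    rw [e]
    exact continuous_flow_smul _
  -- `U p` is the open set of parameters at which some vector with the property `p` is short.
  let U (p : (Fin 2 → 𝓞 K) → Prop) : Set ℝ :=
    ⋃ w ∈ {w | p w ∧ w ≠ 0}, {s | height (flow (Pi.single v s) * g) (intVec w) < ε}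
  have hU (p) : IsOpen (U p) :=
    isOpen_biUnion fun w _ => isOpen_lt (hcont w) continuous_const
  have hsub : Set.Ici s₀ ⊆ U fun w => w₀ 0 * w 1 - w₀ 1 * w 0 = 0 := by
    refine isPreconnected_Ici.subset_left_of_subset_union (hU _)
      (hU fun w => w₀ 0 * w 1 - w₀ 1 * w 0 ≠ 0) ?_ ?_ ?_
    · rw [Set.disjoint_left]
      intro s hs hs'
      obtain ⟨w, ⟨hw, hw0⟩, hws⟩ := Set.mem_iUnion₂.1 hs
      obtain ⟨w', ⟨hw', hw0'⟩, hws'⟩ := Set.mem_iUnion₂.1 hs'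
      have hd := det_eq_zero_of_height_lt hws hws'
      apply hw'
      obtain ⟨j, hj⟩ : ∃ j, w j ≠ 0 := by
        by_contra! h'
        exact hw0 (funext h')
      refine (mul_eq_zero.1 (?_ : w j * _ = 0)).resolve_left hj
      fin_cases j
      · simp only [Fin.zero_eta]
        linear_combination w₀ 0 * hd + w' 0 * hw
      · simp only [Fin.mk_one]
        linear_combination w₀ 1 * hd + w' 1 * hw
    · intro s hs
      obtain ⟨w, hw, hws⟩ := h s hs
      by_cases hd : w₀ 0 * w 1 - w₀ 1 * w 0 = 0
      · exact Or.inl (Set.mem_biUnion (x := w) ⟨hd, hw⟩ hws)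
      · exact Or.inr (Set.mem_biUnion (x := w) ⟨hd, hw⟩ hws)
    · exact ⟨s₀, Set.self_mem_Ici, Set.mem_biUnion (x := w₀) ⟨by ring, hw₀⟩ hs₀⟩
  obtain ⟨j, hj⟩ : ∃ j, w₀ j ≠ 0 := by
    by_contra! h'
    exact hw₀ (funext h')
  -- Up to a constant, `w₀` is itself the shortest vector of its line.
  set N := |(Algebra.norm ℚ (w₀ j : K) : ℝ)|
  have hN : 1 ≤ N := one_le_abs_norm hj
  have hbound : ∀ s ≥ s₀, height (flow (Pi.single v s) * g) (intVec w₀) ≤ N * ε := by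
    intro s hs
    obtain ⟨w, ⟨hw, hw0⟩, hws⟩ := Set.mem_iUnion₂.1 (hsub hs)
    obtain ⟨a, ha⟩ := exists_eq_smul_of_det_eq_zero (y := intVec w) (intVec_ne_zero hw₀) (by
      simp only [intVec, ← map_mul]
      rw [sub_eq_zero.1 hw])
    have ha0 : a ≠ 0 := by
      rintro rfl
      exact intVec_ne_zero hw0 (by rw [ha, zero_smul])
    have hwj : (w j : K) = a * w₀ j := congrFun ha j
    have hwj0 : w j ≠ 0 := by
      intro h0
      exact mul_ne_zero ha0 ((RingOfIntegers.coe_ne_zero_iff).2 hj)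
        (hwj.symm.trans (RingOfIntegers.coe_eq_zero_iff.2 h0))
    have h1 : 1 ≤ |(Algebra.norm ℚ a : ℝ)| * N := by
      have := one_le_abs_norm hwj0
      rwa [hwj, map_mul, Rat.cast_mul, abs_mul] at this
    have hws : height (flow (Pi.single v s) * g) (intVec w) < ε := hws
    rw [ha, height_smul] at hws
    set H := height (flow (Pi.single v s) * g) (intVec w₀)
    have hH : 0 ≤ H := height_nonneg _ _
    calc H ≤ (|(Algebra.norm ℚ a : ℝ)| * N) * H := le_mul_of_one_le_left hH h1
      _ = N * (|(Algebra.norm ℚ a : ℝ)| * H) := by ring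
      _ ≤ N * ε := mul_le_mul_of_nonneg_left hws.le (by positivity)
  -- But the height of `w₀` tends to infinity along the ray if the expanded coordinate is nonzero.
  set x := ‖evalVec g (intVec w₀) v 0‖
  have hx : 0 < x := norm_pos_iff.2 hne
  set Q := ∏ u ∈ Finset.univ.erase v, ‖evalVec g (intVec w₀) u‖ ^ u.mult
  have hQ : 0 < Q := Finset.prod_pos fun u _ =>
    pow_pos (norm_pos_iff.2 (evalVec_ne_zero g (intVec_ne_zero hw₀) u)) _
  have hlow (s : ℝ) : (Real.exp s * x) ^ v.mult * Q ≤
      height (flow (Pi.single v s) * g) (intVec w₀) := by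
    rw [height, ← Finset.mul_prod_erase _ _ (Finset.mem_univ v)]
    refine mul_le_mul ?_ (le_of_eq ?_) hQ.le (by positivity)
    · refine pow_le_pow_left₀ (by positivity) ?_ _
      refine le_trans (le_of_eq ?_) (norm_le_pi_norm _ 0)
      rw [norm_evalVec_flow_mul_zero, Pi.single_eq_same]
    · refine Finset.prod_congr rfl fun u hu => ?_
      rw [evalVec_mul, flow, Pi.single_eq_of_ne (Finset.ne_of_mem_erase hu), boost_zero,
        Matrix.SpecialLinearGroup.coe_one, Matrix.one_mulVec]
  have hlim : Filter.Tendsto (fun s : ℝ => (Real.exp s * x) ^ v.mult * Q) Filter.atTop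
      Filter.atTop :=
    ((Filter.tendsto_pow_atTop v.mult_ne_zero).comp
      (Real.tendsto_exp_atTop.atTop_mul_const hx)).atTop_mul_const hQ
  obtain ⟨s, hs, hs'⟩ := ((hlim.eventually_gt_atTop (N * ε)).and
    (Filter.eventually_ge_atTop s₀)).exists
  exact absurd (hbound s hs') (not_le.2 (hs.trans_le (hlow s)))

lemma height_weyl_mul (g : Grp K) (w : Fin 2 → K) : height (weyl K * g) w = height g w := by
  refine Finset.prod_congr rfl fun v _ => ?_
  congr 1
  have h0 := norm_le_pi_norm (evalVec g w v) 0
  have h1 := norm_le_pi_norm (evalVec g w v) 1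
  have h0' := norm_le_pi_norm (evalVec (weyl K * g) w v) 0
  have h1' := norm_le_pi_norm (evalVec (weyl K * g) w v) 1
  rw [evalVec_weyl_mul_zero] at h0'
  rw [evalVec_weyl_mul_one, norm_neg] at h1'
  refine le_antisymm ((pi_norm_le_iff_of_nonneg (norm_nonneg _)).2 ?_)
    ((pi_norm_le_iff_of_nonneg (norm_nonneg _)).2 ?_) <;> rw [Fin.forall_fin_two]
  · rw [evalVec_weyl_mul_zero, evalVec_weyl_mul_one, norm_neg]
    exact ⟨h1, h0⟩
  · exact ⟨h1', h0'⟩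

/-- If `D_v π(g)` is divergent then `g_v` maps rational lines to both coordinate axes: by Mahler's
criterion, lattices far out in the orbit have short vectors. -/
lemma exists_lines_of_isDivergentOrbit {g : Grp K} {v : InfinitePlace K}
    (h : IsDivergentOrbit (torus {v}) (proj g)) :
    (∃ w : Fin 2 → 𝓞 K, w ≠ 0 ∧ evalVec g (intVec w) v 0 = 0) ∧
      ∃ w : Fin 2 → 𝓞 K, w ≠ 0 ∧ evalVec g (intVec w) v 1 = 0 := by
  classical
  set ε := (∏ v : InfinitePlace K, (2 : ℝ) ^ v.mult)⁻¹
  have hε : 0 < ε := inv_pos.2 (Finset.prod_pos fun v _ => by positivity)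
  obtain ⟨R, hR⟩ := exists_bounded_mul_of_le_height K hε
  have hC : IsCompact ((proj : Grp K → Space K) '' {g | ∀ v i j, ‖g v i j‖ ≤ R}) :=
    (isCompact_entries_le R).image continuous_proj
  have hP := h.isCompact_preimage hC
  have hmem (s : ℝ) : flow (Pi.single v s) ∈ torus {v} :=
    realTorus_le _ (flow_mem_realTorus fun u hu => Pi.single_eq_of_ne (by simpa using hu) _)
  have hbdd (i j : Fin 2) : ∃ M : ℝ, ∀ d : torus {v}, ‖(d : Grp K) v i j‖ > M →
      ∃ w : Fin 2 → 𝓞 K, w ≠ 0 ∧ height ((d : Grp K) * g) (intVec w) < ε := by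
    obtain ⟨M, hM⟩ := (hP.image (f := fun d : torus {v} => ‖(d : Grp K) v i j‖)
      ((continuous_entry v i j).norm.comp continuous_subtype_val)).bddAbove
    refine ⟨M, fun d hd => ?_⟩
    by_contra! hw
    obtain ⟨δ, hδ⟩ := hR ((d : Grp K) * g) hw
    exact absurd (hM ⟨d, ⟨_, hδ, (proj_eq_iff.2 ⟨δ, rfl⟩).symm⟩, rfl⟩) (not_le.2 hd)
  constructor
  · obtain ⟨M, hM⟩ := hbdd 0 0
    refine exists_line_of_ray (v := v) (s₀ := M) fun s hs => hM ⟨_, hmem s⟩ ?_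
    simp only [flow, Pi.single_eq_same, boost_zero_zero, norm_realEmbedding, Real.abs_exp]
    linarith [Real.add_one_le_exp s]
  · obtain ⟨M, hM⟩ := hbdd 1 1
    -- The opposite ray is reduced to the first one by interchanging the coordinates.
    obtain ⟨w, hw0, hw⟩ := exists_line_of_ray (g := weyl K * g) (v := v) (s₀ := M) fun s hs => by
      obtain ⟨w, hw0, hw⟩ := hM ⟨_, hmem (-s)⟩ (by
        simp only [flow, Pi.single_eq_same, boost_one_one, norm_realEmbedding, Real.abs_exp,
          neg_neg]
        linarith [Real.add_one_le_exp s])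
      refine ⟨w, hw0, ?_⟩
      have e : (Pi.single v s : InfinitePlace K → ℝ) = -Pi.single v (-s) := by
        rw [← Pi.single_neg, neg_neg]
      rwa [← mul_assoc, e, ← weyl_mul_flow, mul_assoc, height_weyl_mul]
    exact ⟨w, hw0, by rwa [evalVec_weyl_mul_zero] at hw⟩

lemma exists_height_eq_of_proj_eq {g h : Grp K} (hgh : proj g = proj h) {w : Fin 2 → 𝓞 K}
    (hw : w ≠ 0) : ∃ w' : Fin 2 → 𝓞 K, w' ≠ 0 ∧ height g (intVec w) = height h (intVec w') := by
  obtain ⟨δ, hδ⟩ := proj_eq_iff.1 hgh.symm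
  refine ⟨δ.1.mulVec w, ?_, by rw [hδ, height_mul_diagonalEmbedding, intMatrix_mulVec]⟩
  intro h0
  have := congrArg intVec h0
  rw [← intMatrix_mulVec] at this
  exact mulVec_ne_zero (intMatrix δ) (intVec_ne_zero hw) (this.trans (funext fun j => by
    simp [intVec]))

/-- If `g_v w` is on a coordinate axis then an element of `D_v` multiplies the height of `w` by a
power of one of its diagonal entries. -/
lemma height_mul_of_mem_torus {d g : Grp K} {v : InfinitePlace K} (hd : d ∈ torus {v})
    {w : Fin 2 → K} {i j : Fin 2} (hij : i ≠ j) (h : evalVec g w v i = 0) :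
    height (d * g) w = ‖d v j j‖ ^ v.mult * height g w := by
  classical
  rw [mem_torus] at hd
  have hdiag := localTorus_le v (hd.1 v rfl)
  rw [height, height, ← Finset.mul_prod_erase _ _ (Finset.mem_univ v),
    ← Finset.mul_prod_erase _ (fun u => ‖evalVec g w u‖ ^ u.mult) (Finset.mem_univ v),
    ← mul_assoc, ← mul_pow]
  congr 1
  · rw [evalVec_mul, ← norm_smul]
    congr 2
    funext k
    fin_cases i <;> fin_cases j <;> fin_cases k <;>
      simp_all [Matrix.mulVec, dotProduct, Fin.sum_univ_two, hdiag.1, hdiag.2]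
  · refine Finset.prod_congr rfl fun u hu => ?_
    rw [evalVec_mul, hd.2 u (by simpa using Finset.ne_of_mem_erase hu),
        Matrix.SpecialLinearGroup.coe_one, Matrix.one_mulVec]

lemma le_one_add_pow {x : ℝ} (hx : 0 ≤ x) {n : ℕ} (hn : n ≠ 0) : x ≤ 1 + x ^ n := by
  rcases le_total x 1 with h | h
  · linarith [pow_nonneg hx n]
  · linarith [le_self_pow₀ h hn]

/-- If `g_v` maps rational lines to both coordinate axes then `D_v π(g)` is divergent: over a
compact set the heights of the two lines are bounded below, so neither diagonal entry can be large. -/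
lemma isDivergentOrbit_of_lines {g : Grp K} {v : InfinitePlace K} {w w' : Fin 2 → 𝓞 K}
    (hw : w ≠ 0) (hw' : w' ≠ 0) (h : evalVec g (intVec w) v 0 = 0)
    (h' : evalVec g (intVec w') v 1 = 0) : IsDivergentOrbit (torus {v}) (proj g) := by
  have hcont : Continuous fun d : torus {v} => d • proj g :=
    (continuous_subtype_val : Continuous fun d : torus {v} => (d : Grp K)).smul continuous_const
  refine isProperMap_iff_isCompact_preimage.2 ⟨hcont, fun C hC => ?_⟩
  obtain ⟨R, hR⟩ := exists_bounded_lift hC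
  set P := ∏ v : InfinitePlace K, (2 * R) ^ v.mult
  set B := 1 + P * (height g (intVec w) + height g (intVec w'))
  -- A bound below for one of the diagonal entries is a bound above for the other.
  have key {i j : Fin 2} (hij : i ≠ j) {w : Fin 2 → 𝓞 K} (hw : w ≠ 0)
      (h : evalVec g (intVec w) v i = 0) {d : torus {v}} (hd : d • proj g ∈ C) :
      0 ≤ P ∧ ‖(d : Grp K) v i i‖ ≤ 1 + P * height g (intVec w) := by
    obtain ⟨y, hy, hyR⟩ := hR _ hd
    obtain ⟨w', hw'0, hw'⟩ := exists_height_eq_of_proj_eq (g := (d : Grp K) * g) (h := y) hy.symm hw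
    have h1 := one_le_mul_height hyR hw'0
    rw [← hw', height_mul_of_mem_torus d.2 hij h] at h1
    have hP : 0 ≤ P := Finset.prod_nonneg fun u _ => pow_nonneg (by
      have := (norm_nonneg _).trans (hyR u 0 0)
      linarith) _
    refine ⟨hP, (le_one_add_pow (norm_nonneg _) v.mult_ne_zero).trans ?_⟩
    have hdiag := localTorus_le v ((mem_torus.1 d.2).1 v rfl)
    have hdet : ‖(d : Grp K) v i i‖ * ‖(d : Grp K) v j j‖ = 1 := by
      have := det_eq_one ((d : Grp K) v)
      rw [hdiag.1, zero_mul, sub_zero] at this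
      rw [← norm_mul]
      fin_cases i <;> fin_cases j <;> simp_all
      rw [mul_comm, ← norm_mul, this, norm_one]
    have hpow : ‖(d : Grp K) v i i‖ ^ v.mult * ‖(d : Grp K) v j j‖ ^ v.mult = 1 := by
      rw [← mul_pow, hdet, one_pow]
    have := mul_le_mul_of_nonneg_left h1 (by positivity : 0 ≤ ‖(d : Grp K) v i i‖ ^ v.mult)
    have e : ‖(d : Grp K) v i i‖ ^ v.mult * (P * (‖(d : Grp K) v j j‖ ^ v.mult *
        height g (intVec w))) = P * height g (intVec w) := by
      linear_combination P * height g (intVec w) * hpow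
    linarith
  have hsub : (fun d : torus {v} => d • proj g) ⁻¹' C ⊆
      Subtype.val ⁻¹' {d : Grp K | ∀ v i j, ‖d v i j‖ ≤ B} := by
    intro d hd u i j
    obtain ⟨hP, h1⟩ := key (by decide : (0 : Fin 2) ≠ 1) hw h hd
    obtain ⟨-, h2⟩ := key (by decide : (1 : Fin 2) ≠ 0) hw' h' hd
    have e1 := mul_nonneg hP (height_nonneg g (intVec w))
    have e2 := mul_nonneg hP (height_nonneg g (intVec w'))
    have hB : B = 1 + P * height g (intVec w) + P * height g (intVec w') := by
      simp only [B]; ring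
    rw [hB]
    have hd' := mem_torus.1 d.2
    by_cases hu : u = v
    · subst hu
      have hdiag := localTorus_le u (hd'.1 u rfl)
      fin_cases i <;> fin_cases j
      · simp only [Fin.zero_eta]; linarith
      · simp only [Fin.zero_eta, Fin.mk_one, hdiag.1, norm_zero]; linarith
      · simp only [Fin.zero_eta, Fin.mk_one, hdiag.2, norm_zero]; linarith
      · simp only [Fin.mk_one]; linarith
    · rw [hd'.2 u hu]
      have : ‖(1 : LocalGroup u) i j‖ ≤ 1 := by
        fin_cases i <;> fin_cases j <;> simp
      linarith
  exact ((isClosed_torus {v}).isClosedEmbedding_subtypeVal.isCompact_preimage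
    (isCompact_entries_le B)).of_isClosed_subset (hC.isClosed.preimage hcont) hsub

/-- The orbit `D_v π(g)` is divergent if and only if `g ∈ N_G(D_v) G_K`. -/
theorem isDivergentOrbit_iff {g : Grp K} {v : InfinitePlace K} :
    IsDivergentOrbit (torus {v}) (proj g) ↔ g ∈ normalizerMulRational (torus {v}) := by
  rw [mem_normalizerMulRational]
  constructor
  · intro h
    obtain ⟨⟨w, hw0, hw⟩, w', hw0', hw'⟩ := exists_lines_of_isDivergentOrbit h
    obtain ⟨γ, hγ⟩ := exists_diagonal_of_lines hw0 hw0' hw hw'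
    refine ⟨γ, fun u hu => ?_⟩
    obtain rfl : u = v := hu
    exact ⟨by rw [hγ.1, mul_zero], by rw [hγ.2, zero_mul]⟩
  · rintro ⟨γ, hγ⟩
    obtain ⟨⟨w, hw0, hw⟩, w', hw0', hw'⟩ := exists_lines_of_isMonomial (hγ v rfl)
    exact isDivergentOrbit_of_lines hw0 hw0' hw hw'

end Divergence

/-! ### Closed groups of diagonal matrices -/

section ClosedSubgroups

/-- The small elements of a closed subgroup `A` of a finite-dimensional real vector space span
lines contained in `A`. Otherwise, modulo the largest subspace contained in `A`, there are
elements of `A` tending to `0`, and a limit of the directions they define spans a line in `A`. -/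
theorem exists_smul_mem_of_norm_lt {E : Type*} [NormedAddCommGroup E] [NormedSpace ℝ E]
    [FiniteDimensional ℝ E] {A : AddSubgroup E} (hA : IsClosed (A : Set E)) :
    ∃ ε > 0, ∀ x ∈ A, ‖x‖ < ε → ∀ s : ℝ, s • x ∈ A := by
  -- The largest subspace contained in `A`.
  let W : Submodule ℝ E :=
    { carrier := {x | ∀ s : ℝ, s • x ∈ A}
      zero_mem' := fun s => by rw [smul_zero]; exact A.zero_mem
      add_mem' := fun hx hy s => by rw [smul_add]; exact A.add_mem (hx s) (hy s)
      smul_mem' := fun c x hx s => by rw [smul_smul]; exact hx _ }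
  have hWA {x : E} (hx : x ∈ W) : x ∈ A := by simpa using hx 1
  obtain ⟨W', hW⟩ := W.exists_isCompl
  set P := W'.projection W hW.symm
  have hP : Continuous P := P.continuous_of_finiteDimensional
  by_contra! hcon
  choose x hxA hxε s hs using fun n : ℕ => hcon (1 / ((n : ℝ) + 1)) (by positivity)
  have hx0 : Filter.Tendsto x Filter.atTop (nhds 0) :=
    squeeze_zero_norm (fun n => (hxε n).le) tendsto_one_div_add_atTop_nhds_zero_nat
  set y := fun n => P (x n)
  have hy0 : Filter.Tendsto y Filter.atTop (nhds 0) := by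
    have := (hP.tendsto 0).comp hx0
    rwa [map_zero] at this
  have hyA (n) : y n ∈ A := by
    have h1 := hWA (Submodule.sub_projection_mem hW.symm (x n))
    have := A.sub_mem (hxA n) h1
    rwa [sub_sub_cancel] at this
  have hyW' (n) : y n ∈ W' := Submodule.projection_apply_mem hW.symm (x n)
  have hyne (n) : y n ≠ 0 := fun h =>
    hs n ((Submodule.projection_apply_eq_zero_iff hW.symm).1 h (s n))
  have hsph (n) : ‖y n‖⁻¹ • y n ∈ Metric.sphere (0 : E) 1 := by
    simp [norm_smul, hyne n]
  obtain ⟨u, hu, φ, hφ, hlim⟩ := (isCompact_sphere (0 : E) 1).tendsto_subseq hsph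
  have huW' : u ∈ W' := W'.closed_of_finiteDimensional.mem_of_tendsto hlim
    (Filter.Eventually.of_forall fun n => W'.smul_mem _ (hyW' _))
  -- A multiple `s • u` is approximated by integral multiples of the small elements `y n`.
  have huW : u ∈ W := by
    intro s
    have h1 : Filter.Tendsto (fun n => s • (‖y (φ n)‖⁻¹ • y (φ n))) Filter.atTop (nhds (s • u)) :=
      hlim.const_smul s
    have h2 : Filter.Tendsto (fun n => ⌊s * ‖y (φ n)‖⁻¹⌋ • y (φ n) -
        s • (‖y (φ n)‖⁻¹ • y (φ n))) Filter.atTop (nhds 0) := by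
      refine squeeze_zero_norm (a := fun n => ‖y (φ n)‖) (fun n => ?_) ?_
      · rw [smul_smul, ← Int.cast_smul_eq_zsmul ℝ, ← sub_smul, norm_smul]
        refine mul_le_of_le_one_left (norm_nonneg _) ?_
        rw [Real.norm_eq_abs, abs_sub_comm, Int.self_sub_floor, abs_of_nonneg (Int.fract_nonneg _)]
        exact (Int.fract_lt_one _).le
      · have := (hy0.comp hφ.tendsto_atTop).norm
        rwa [norm_zero] at this
    have h3 := h2.add h1
    simp only [sub_add_cancel, zero_add] at h3
    exact hA.mem_of_tendsto h3 (Filter.Eventually.of_forall fun n => A.zsmul_mem (hyA _) _)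
  have hu0 : u = 0 := (Submodule.disjoint_def.1 hW.disjoint) u huW huW'
  simp [hu0] at hu

variable {K : Type*} [Field K]

local notation "ι" => InfinitePlace.Completion.extensionEmbedding

lemma tendsto_Grp {X : Type*} {l : Filter X} {f : X → Grp K} {g : Grp K}
    (h : ∀ v i j, Filter.Tendsto (fun x => f x v i j) l (nhds (g v i j))) :
    Filter.Tendsto f l (nhds g) := by
  refine tendsto_pi_nhds.2 fun v => ?_
  refine Topology.IsInducing.subtypeVal.tendsto_nhds_iff.2 ?_
  exact tendsto_pi_nhds.2 fun i => tendsto_pi_nhds.2 fun j => h v i j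

/-- The diagonal matrix with diagonal entries `a` and `a⁻¹`. -/
def diagMatrix {F : Type*} [Field F] (a : F) (ha : a ≠ 0) : Matrix.SpecialLinearGroup (Fin 2) F :=
  ⟨!![a, 0; 0, a⁻¹], by simp [Matrix.det_fin_two, ha]⟩

section
variable {F : Type*} [Field F] (a : F) (ha : a ≠ 0)
@[simp] lemma diagMatrix_zero_one : diagMatrix a ha 0 1 = 0 := rfl
@[simp] lemma diagMatrix_one_zero : diagMatrix a ha 1 0 = 0 := rfl
@[simp] lemma diagMatrix_one_one : diagMatrix a ha 1 1 = a⁻¹ := rfl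
end

lemma diagonal_mul_eq_one {F : Type*} [Field F] {d : Matrix.SpecialLinearGroup (Fin 2) F}
    (hd : d 0 1 = 0 ∧ d 1 0 = 0) : d 0 0 * d 1 1 = 1 := by
  simpa [hd.1] using det_eq_one d

lemma diagonal_ne_zero {F : Type*} [Field F] {d : Matrix.SpecialLinearGroup (Fin 2) F}
    (hd : d 0 1 = 0 ∧ d 1 0 = 0) : d 0 0 ≠ 0 :=
  left_ne_zero_of_mul_eq_one (diagonal_mul_eq_one hd)

lemma diagonal_one_one {F : Type*} [Field F] {d : Matrix.SpecialLinearGroup (Fin 2) F}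
    (hd : d 0 1 = 0 ∧ d 1 0 = 0) : d 1 1 = (d 0 0)⁻¹ :=
  eq_inv_of_mul_eq_one_right (diagonal_mul_eq_one hd)

lemma diagonal_ext {F : Type*} [Field F] {d e : Matrix.SpecialLinearGroup (Fin 2) F}
    (hd : d 0 1 = 0 ∧ d 1 0 = 0) (he : e 0 1 = 0 ∧ e 1 0 = 0) (h : d 0 0 = e 0 0) : d = e := by
  refine Matrix.SpecialLinearGroup.ext _ _ fun i j => ?_
  fin_cases i <;> fin_cases j
  · exact h
  · exact hd.1.trans he.1.symm
  · exact hd.2.trans he.2.symm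
  · exact (diagonal_one_one hd).trans ((congrArg _ h).trans (diagonal_one_one he).symm)

variable (K) in
/-- The subgroup of `G` of elements all of whose components are diagonal. -/
def diagonalGrp : Subgroup (Grp K) := Subgroup.pi Set.univ diagonalSubgroup

lemma mem_diagonalGrp {g : Grp K} :
    g ∈ diagonalGrp K ↔ ∀ v, g v 0 1 = 0 ∧ g v 1 0 = 0 := by
  simp only [diagonalGrp, Subgroup.mem_pi, Set.mem_univ, true_imp_iff]
  rfl

lemma isClosed_diagonalGrp : IsClosed (diagonalGrp K : Set (Grp K)) := by
  have : (diagonalGrp K : Set (Grp K)) =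
      Set.univ.pi fun v => (diagonalSubgroup v : Set (LocalGroup v)) := rfl
  rw [this]
  exact isClosed_set_pi fun v _ => isClosed_diagonalSubgroup v

lemma torus_le_diagonalGrp : torus (Set.univ : Set (InfinitePlace K)) ≤ diagonalGrp K :=
  fun _ hg => mem_diagonalGrp.2 fun v => localTorus_le v ((mem_torus.1 hg).1 v trivial)

lemma diagonalGrp_comm {d e : Grp K} (hd : d ∈ diagonalGrp K) (he : e ∈ diagonalGrp K) :
    d * e = e * d := by
  rw [mem_diagonalGrp] at hd he
  refine funext fun v => Matrix.SpecialLinearGroup.ext _ _ fun i j => ?_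
  simp only [Pi.mul_apply, Matrix.SpecialLinearGroup.coe_mul, Matrix.mul_apply, Fin.sum_univ_two]
  fin_cases i <;> fin_cases j <;> simp [hd v, he v, mul_comm]

lemma le_torus_univ_of_isConnected {T : Subgroup (Grp K)} (hT : IsConnected (T : Set (Grp K)))
    (h : T ≤ diagonalGrp K) : T ≤ torus Set.univ := by
  intro t ht
  refine mem_torus.2 ⟨fun v _ => ?_, fun v hv => absurd trivial hv⟩
  refine mem_identityComponent (C := (fun g : Grp K => g v) '' T)
    (hT.isPreconnected.image _ (continuous_apply v).continuousOn) ⟨1, T.one_mem, rfl⟩ ?_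
    ⟨t, ht, rfl⟩
  rintro _ ⟨g, hg, rfl⟩
  exact mem_diagonalGrp.1 (h hg) v

/-- The logarithms, in `ℂ^r`, of the upper left entries of the elements of a group of diagonal
matrices. -/
def logSubgroup (H : Subgroup (Grp K)) (hH : H ≤ diagonalGrp K) :
    AddSubgroup (InfinitePlace K → ℂ) where
  carrier := {x | ∃ h ∈ H, ∀ v, ι v (h v 0 0) = Complex.exp (x v)}
  zero_mem' := ⟨1, H.one_mem, fun v => by simp⟩
  add_mem' := by
    rintro x y ⟨h, hh, hx⟩ ⟨k, hk, hy⟩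
    refine ⟨h * k, H.mul_mem hh hk, fun v => ?_⟩
    have := (mem_diagonalGrp.1 (hH hh) v).1
    simp [Matrix.mul_apply, Fin.sum_univ_two, this, hx v, hy v, Complex.exp_add]
  neg_mem' := by
    rintro x ⟨h, hh, hx⟩
    refine ⟨h⁻¹, H.inv_mem hh, fun v => ?_⟩
    have := diagonal_one_one (mem_diagonalGrp.1 (hH hh) v)
    simp [Matrix.adjugate_fin_two, this, hx v, Complex.exp_neg]

/-- The group of logarithms is closed: a limit of logarithms has a nonzero exponential, which
therefore is the upper left entry of a diagonal matrix. -/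
lemma isClosed_logSubgroup [NumberField K] {H : Subgroup (Grp K)} (hH : H ≤ diagonalGrp K)
    (hcl : IsClosed (H : Set (Grp K))) :
    IsClosed (logSubgroup H hH : Set (InfinitePlace K → ℂ)) := by
  refine isClosed_of_closure_subset fun x hx => ?_
  obtain ⟨y, hy, hlim⟩ := mem_closure_iff_seq_limit.1 hx
  choose h hhH hh using hy
  have hexp (v) : Filter.Tendsto (fun n => ι v (h n v 0 0)) Filter.atTop
      (nhds (Complex.exp (x v))) := by
    simp_rw [hh]
    exact (Complex.continuous_exp.tendsto _).comp ((tendsto_pi_nhds.1 hlim) v)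
  have hp (v) : ∃ p, ι v p = Complex.exp (x v) :=
    (isClosedEmbedding_extensionEmbedding v).isClosed_range.mem_of_tendsto (hexp v)
      (Filter.Eventually.of_forall fun n => ⟨_, rfl⟩)
  choose p hp using hp
  have hp0 (v) : p v ≠ 0 := fun h0 => Complex.exp_ne_zero (x v) (by rw [← hp, h0, map_zero])
  have hlim0 (v) : Filter.Tendsto (fun n => h n v 0 0) Filter.atTop (nhds (p v)) := by
    rw [(isClosedEmbedding_extensionEmbedding v).isInducing.tendsto_nhds_iff, hp]
    exact hexp v
  have hd (n v) := mem_diagonalGrp.1 (hH (hhH n)) v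
  have hlimh : Filter.Tendsto h Filter.atTop (nhds fun v => diagMatrix (p v) (hp0 v)) := by
    refine tendsto_Grp fun v i j => ?_
    fin_cases i <;> fin_cases j
    · exact hlim0 v
    · simp [hd _ v]
    · simp [hd _ v]
    · have e (n) : h n v 1 1 = (h n v 0 0)⁻¹ := diagonal_one_one (hd n v)
      simp only [Fin.mk_one, e, diagMatrix_one_one]
      exact (hlim0 v).inv₀ (hp0 v)
  exact ⟨_, hcl.mem_of_tendsto hlimh (Filter.Eventually.of_forall hhH), hp⟩

/-- The identity component of a closed group of diagonal matrices is open in the group. -/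
lemma exists_nhds_inter_subset_identityComponent [NumberField K] {H : Subgroup (Grp K)}
    (hH : H ≤ diagonalGrp K) (hcl : IsClosed (H : Set (Grp K))) :
    ∃ U ∈ nhds (1 : Grp K), U ∩ H ⊆ identityComponent H := by
  obtain ⟨ε, hε, hlog⟩ := exists_smul_mem_of_norm_lt (isClosed_logSubgroup hH hcl)
  refine ⟨{g | ∀ v, ‖Complex.log (ι v (g v 0 0))‖ < ε}, ?_, ?_⟩
  · refine Filter.eventually_all.2 fun v => ?_
    have h1 : ContinuousAt (fun g : Grp K => ‖Complex.log (ι v (g v 0 0))‖) 1 := by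
      refine ContinuousAt.norm (ContinuousAt.clog ?_ (by simp))
      exact ((isClosedEmbedding_extensionEmbedding v).continuous.comp
        (continuous_entry v 0 0)).continuousAt
    exact h1.eventually_lt continuousAt_const (by simpa using hε)
  · rintro h ⟨hU, hhH⟩
    have hd := mem_diagonalGrp.1 (hH hhH)
    set x : InfinitePlace K → ℂ := fun v => Complex.log (ι v (h v 0 0))
    have hxexp (v) : Complex.exp (x v) = ι v (h v 0 0) :=
      Complex.exp_log ((map_ne_zero _).2 (diagonal_ne_zero (hd v)))
    have hx : x ∈ logSubgroup H hH := ⟨h, hhH, fun v => (hxexp v).symm⟩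
    have hxε : ‖x‖ < ε := (pi_norm_lt_iff hε).2 hU
    choose f hfH hf using hlog x hx hxε
    have hfd (s) := mem_diagonalGrp.1 (hH (hfH s))
    have hc0 (v) : Continuous fun s => f s v 0 0 := by
      rw [(isClosedEmbedding_extensionEmbedding v).isInducing.continuous_iff]
      have : (⇑(ι v) ∘ fun s => f s v 0 0) = fun s => Complex.exp ((s • x) v) :=
        funext fun s => hf s v
      rw [this]
      refine Complex.continuous_exp.comp ?_
      exact (continuous_id.smul continuous_const)
    have hfc : Continuous f := by
      refine continuous_pi fun v => continuous_localGroup fun i j => ?_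
      fin_cases i <;> fin_cases j
      · exact hc0 v
      · simpa [hfd _ v] using continuous_const
      · simpa [hfd _ v] using continuous_const
      · have e (s) : f s v 1 1 = (f s v 0 0)⁻¹ := diagonal_one_one (hfd s v)
        simp only [Fin.mk_one, e]
        exact (hc0 v).inv₀ fun s => diagonal_ne_zero (hfd s v)
    have h0 : f 0 = 1 := funext fun v => diagonal_ext (hfd 0 v) (by simp)
      ((ι v).injective (by rw [hf]; simp))
    have h1 : f 1 = h := funext fun v => diagonal_ext (hfd 1 v) (hd v)
      ((ι v).injective (by rw [hf, one_smul, hxexp]))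
    exact mem_identityComponent (isPreconnected_range hfc) ⟨0, h0⟩
      (by rintro _ ⟨s, rfl⟩; exact hfH s) ⟨1, h1⟩

end ClosedSubgroups

/-! ### Closures of orbits of rational points -/

section OrbitClosure

variable {K : Type*} [Field K]

/-- The products of an entry of the first row with one of the second determine a matrix in `SL(2)`
up to left multiplication by a diagonal matrix. -/
lemma exists_diagonal_mul_eq {F : Type*} [Field F] {m m' : Matrix.SpecialLinearGroup (Fin 2) F}
    (h : ∀ i j, m 0 i * m 1 j = m' 0 i * m' 1 j) :
    ∃ a : Matrix.SpecialLinearGroup (Fin 2) F, (a 0 1 = 0 ∧ a 1 0 = 0) ∧ m' = a * m := by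
  refine ⟨m' * m⁻¹, ⟨?_, ?_⟩, by simp⟩
  · have e : (m' * m⁻¹) 0 1 = m' 0 1 * m 0 0 - m' 0 0 * m 0 1 := by
      simp [Matrix.mul_apply, Fin.sum_univ_two, Matrix.adjugate_fin_two]
      ring
    rw [e]
    have h1 : (m' 0 1 * m 0 0 - m' 0 0 * m 0 1) * m' 1 0 = 0 := by
      linear_combination m 0 1 * h 0 0 - m 0 0 * h 1 0
    have h2 : (m' 0 1 * m 0 0 - m' 0 0 * m 0 1) * m' 1 1 = 0 := by
      linear_combination m 0 1 * h 0 1 - m 0 0 * h 1 1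
    linear_combination m' 0 0 * h2 - m' 0 1 * h1 -
      (m' 0 1 * m 0 0 - m' 0 0 * m 0 1) * det_eq_one m'
  · have e : (m' * m⁻¹) 1 0 = m' 1 0 * m 1 1 - m' 1 1 * m 1 0 := by
      simp [Matrix.mul_apply, Fin.sum_univ_two, Matrix.adjugate_fin_two]
      ring
    rw [e]
    have h1 : (m' 1 0 * m 1 1 - m' 1 1 * m 1 0) * m' 0 0 = 0 := by
      linear_combination m 1 0 * h 0 1 - m 1 1 * h 0 0
    have h2 : (m' 1 0 * m 1 1 - m' 1 1 * m 1 0) * m' 0 1 = 0 := by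
      linear_combination m 1 0 * h 1 1 - m 1 1 * h 1 0
    linear_combination m' 1 1 * h1 - m' 1 0 * h2 -
      (m' 1 0 * m 1 1 - m' 1 1 * m 1 0) * det_eq_one m'

variable [NumberField K]

lemma exists_common_denominator (γ : Matrix.SpecialLinearGroup (Fin 2) K) :
    ∃ D : 𝓞 K, D ≠ 0 ∧ ∃ G : Fin 2 → Fin 2 → 𝓞 K, ∀ i j, (G i j : K) = D * γ i j := by
  obtain ⟨b, hb⟩ := IsLocalization.exist_integer_multiples_of_finite (nonZeroDivisors (𝓞 K))
    fun p : Fin 2 × Fin 2 => γ p.1 p.2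
  choose G hG using hb
  refine ⟨b, nonZeroDivisors.coe_ne_zero b, fun i j => G (i, j), fun i j => ?_⟩
  have := hG (i, j)
  rwa [Algebra.smul_def] at this

/-- The set `A γ Γ`, with `A` the group of diagonal matrices, is locally contained in a single
coset of `A`: near any point `x` all its elements come from the same coset. -/
lemma exists_nhds_same_coset (γ : Matrix.SpecialLinearGroup (Fin 2) K) (x : Grp K) :
    ∃ U ∈ nhds x, ∀ s ∈ diagonalGrp K, ∀ s' ∈ diagonalGrp K, ∀ δ δ',
      s * diagonalEmbedding K (γ * intMatrix δ) ∈ U →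
      s' * diagonalEmbedding K (γ * intMatrix δ') ∈ U →
      ∃ a : Matrix.SpecialLinearGroup (Fin 2) K, (a 0 1 = 0 ∧ a 1 0 = 0) ∧
        γ * intMatrix δ' = a * (γ * intMatrix δ) := by
  obtain ⟨D, hD, G, hG⟩ := exists_common_denominator γ
  -- The invariants of `exists_diagonal_mul_eq`, multiplied by a common denominator, are integral on
  -- `A γ Γ`.
  let q (m : Grp K) (i j : Fin 2) (v : InfinitePlace K) : v.Completion :=
    algebraMap K v.Completion (D * D : K) * (m v 0 i * m v 1 j)
  refine ⟨{m | ∀ v i j, ‖q m i j v - q x i j v‖ < 1 / 2}, ?_, ?_⟩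
  · refine Filter.eventually_all.2 fun v => Filter.eventually_all.2 fun i =>
      Filter.eventually_all.2 fun j => ?_
    have hc : Continuous fun g : Grp K => ‖q g i j v - q x i j v‖ :=
      ((continuous_const.mul ((continuous_entry v 0 i).mul (continuous_entry v 1 j))).sub
        continuous_const).norm
    exact hc.continuousAt.eventually_lt continuousAt_const (by simp)
  · intro s hs s' hs' δ δ' h h'
    let N (δ : Matrix.SpecialLinearGroup (Fin 2) (𝓞 K)) (i j : Fin 2) : 𝓞 K :=
      (G 0 0 * δ 0 i + G 0 1 * δ 1 i) * (G 1 0 * δ 0 j + G 1 1 * δ 1 j)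
    have hN (δ) (i j : Fin 2) : (N δ i j : K) =
        D * D * ((γ * intMatrix δ) 0 i * (γ * intMatrix δ) 1 j) := by
      simp only [N, map_add, map_mul, hG, Matrix.SpecialLinearGroup.coe_mul, Matrix.mul_apply,
        Fin.sum_univ_two, intMatrix_apply]
      ring
    have hq {s : Grp K} (hs : s ∈ diagonalGrp K) (δ) (i j : Fin 2) (v : InfinitePlace K) :
        q (s * diagonalEmbedding K (γ * intMatrix δ)) i j v =
          algebraMap K v.Completion (N δ i j : K) := by
      have hd := mem_diagonalGrp.1 hs v
      have h1 := diagonal_mul_eq_one hd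
      rw [hN, map_mul (algebraMap K v.Completion) (D * D : K),
        map_mul (algebraMap K v.Completion) ((γ * intMatrix δ) 0 i)]
      simp only [q]
      rw [Pi.mul_apply, Matrix.SpecialLinearGroup.coe_mul, Matrix.mul_apply, Matrix.mul_apply,
        Fin.sum_univ_two, Fin.sum_univ_two, hd.1, hd.2]
      simp only [diagonalEmbedding_apply]
      linear_combination (algebraMap K v.Completion (D * D : K) *
        algebraMap K v.Completion ((γ * intMatrix δ) 0 i) *
        algebraMap K v.Completion ((γ * intMatrix δ) 1 j)) * h1
    have heq (i j : Fin 2) : N δ i j = N δ' i j :=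
      int_eq_of_norm_sub_lt (x := fun v => q x i j v)
        (fun v => by rw [← hq hs]; exact h v i j) (fun v => by rw [← hq hs']; exact h' v i j)
    refine exists_diagonal_mul_eq fun i j => ?_
    have hDK : (D * D : K) ≠ 0 := mul_ne_zero (by simpa using hD) (by simpa using hD)
    refine mul_left_cancel₀ hDK ?_
    rw [← hN, ← hN, heq]

/-- The group of diagonal matrices fixing the point `π(γ)`. -/
def diagonalStabilizer (γ : Matrix.SpecialLinearGroup (Fin 2) K) : Subgroup (Grp K) :=
  diagonalGrp K ⊓ MulAction.stabilizer (Grp K) (proj (diagonalEmbedding K γ))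

lemma mem_sup_of_commute {G : Type*} [Group G] {S U : Subgroup G}
    (h : ∀ s ∈ S, ∀ u ∈ U, s * u = u * s) {g : G} (hg : g ∈ S ⊔ U) :
    ∃ s ∈ S, ∃ u ∈ U, g = s * u := by
  let SU : Subgroup G :=
    { carrier := {g | ∃ s ∈ S, ∃ u ∈ U, g = s * u}
      one_mem' := ⟨1, S.one_mem, 1, U.one_mem, by simp⟩
      mul_mem' := by
        rintro _ _ ⟨s, hs, u, hu, rfl⟩ ⟨s', hs', u', hu', rfl⟩
        refine ⟨s * s', S.mul_mem hs hs', u * u', U.mul_mem hu hu', ?_⟩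
        rw [mul_assoc, ← mul_assoc u, ← h s' hs' u hu]
        simp only [mul_assoc]
      inv_mem' := by
        rintro _ ⟨s, hs, u, hu, rfl⟩
        refine ⟨s⁻¹, S.inv_mem hs, u⁻¹, U.inv_mem hu, ?_⟩
        rw [h s hs u hu, mul_inv_rev] }
  have h1 : S ≤ SU := fun s hs => ⟨s, hs, 1, U.one_mem, by simp⟩
  have h2 : U ≤ SU := fun u hu => ⟨1, S.one_mem, u, hu, by simp⟩
  exact sup_le h1 h2 hg

/-- A point in the closure of `S π(γ)` is `h π(γ)` for some `h` in the closure of `S U`, where `U`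
is the group of diagonal matrices fixing `π(γ)`. -/
lemma exists_mul_mem_closure {S : Subgroup (Grp K)} (hS : S ≤ diagonalGrp K)
    (γ : Matrix.SpecialLinearGroup (Fin 2) K) {g : Grp K}
    (hy : proj g ∈ closure (MulAction.orbit S (proj (diagonalEmbedding K γ)))) :
    ∃ c : Grp K, proj c = proj (diagonalEmbedding K γ) ∧
      g * c⁻¹ ∈ (S ⊔ diagonalStabilizer γ).topologicalClosure := by
  have hg : g ∈ closure (proj ⁻¹' MulAction.orbit S (proj (diagonalEmbedding K γ))) := by
    rw [← isOpenMap_proj.preimage_closure_eq_closure_preimage continuous_proj]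
    exact hy
  have hpre {m : Grp K} (hm : m ∈ proj ⁻¹' MulAction.orbit S (proj (diagonalEmbedding K γ))) :
      ∃ s ∈ S, ∃ δ, m = s * diagonalEmbedding K (γ * intMatrix δ) := by
    obtain ⟨⟨s, hs⟩, hsm⟩ := hm
    have hsm' : proj (s * diagonalEmbedding K γ) = proj m := hsm
    obtain ⟨δ, hδ⟩ := proj_eq_iff.1 hsm'
    exact ⟨s, hs, δ, by rw [hδ, map_mul (diagonalEmbedding K), mul_assoc]⟩
  obtain ⟨Y, hY, hcoset⟩ := exists_nhds_same_coset γ g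
  obtain ⟨m₀, hm₀Y, hm₀⟩ := mem_closure_iff_nhds.1 hg Y hY
  obtain ⟨s₀, hs₀, δ₀, rfl⟩ := hpre hm₀
  have hcx : proj (diagonalEmbedding K (γ * intMatrix δ₀)) = proj (diagonalEmbedding K γ) :=
    (proj_eq_iff.2 ⟨δ₀, map_mul _ _ _⟩).symm
  refine ⟨diagonalEmbedding K (γ * intMatrix δ₀), hcx, ?_⟩
  have hcont : Continuous fun m : Grp K => m * (diagonalEmbedding K (γ * intMatrix δ₀))⁻¹ :=
    continuous_id.mul continuous_const
  refine map_mem_closure (f := fun m : Grp K => m * (diagonalEmbedding K (γ * intMatrix δ₀))⁻¹)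
    hcont (mem_closure_inter_of_mem_nhds hg hY) ?_
  rintro m ⟨hm, hmY⟩
  obtain ⟨s, hs, δ, rfl⟩ := hpre hm
  obtain ⟨a, had, ha⟩ := hcoset s₀ (hS hs₀) s (hS hs) δ₀ δ hm₀Y hmY
  have hau : diagonalEmbedding K a ∈ diagonalStabilizer γ := by
    refine ⟨mem_diagonalGrp.2 fun v => ?_, ?_⟩
    · simp only [diagonalEmbedding_apply, had.1, had.2, map_zero, and_self]
    · change diagonalEmbedding K a • proj (diagonalEmbedding K γ) = proj (diagonalEmbedding K γ)
      conv_lhs => rw [← hcx]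
      rw [smul_proj, ← map_mul, ← ha]
      exact (proj_eq_iff.2 ⟨δ, map_mul _ _ _⟩).symm
  have e : s * diagonalEmbedding K (γ * intMatrix δ) *
      (diagonalEmbedding K (γ * intMatrix δ₀))⁻¹ = s * diagonalEmbedding K a := by
    rw [ha, map_mul _ a, ← mul_assoc, mul_inv_cancel_right]
  have hmem := (S ⊔ diagonalStabilizer γ).mul_mem (Subgroup.mem_sup_left hs)
    (Subgroup.mem_sup_right hau)
  rw [← e] at hmem
  exact hmem

/-- The identity component of the closure of `S U` is open in it, and `S U` is dense, so the
closure is the product of its identity component and `U`. -/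
lemma exists_mul_of_mem_topologicalClosure {S U : Subgroup (Grp K)} (hS : S ≤ diagonalGrp K)
    (hSc : IsConnected (S : Set (Grp K))) (hU : U ≤ diagonalGrp K) {h : Grp K}
    (hh : h ∈ (S ⊔ U).topologicalClosure) :
    ∃ t ∈ identityComponent (S ⊔ U).topologicalClosure, ∃ u ∈ U, h = t * u := by
  have hHA : (S ⊔ U).topologicalClosure ≤ diagonalGrp K :=
    Subgroup.topologicalClosure_minimal _ (sup_le hS hU) isClosed_diagonalGrp
  have hle : S ⊔ U ≤ (S ⊔ U).topologicalClosure := Subgroup.le_topologicalClosure _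
  have hcl : IsClosed ((S ⊔ U).topologicalClosure : Set (Grp K)) :=
    Subgroup.isClosed_topologicalClosure _
  generalize hHdef : (S ⊔ U).topologicalClosure = H at *
  have hST : (S : Set (Grp K)) ⊆ identityComponent H :=
    mem_identityComponent hSc.isPreconnected S.one_mem
      fun s hs => hle (Subgroup.mem_sup_left hs)
  obtain ⟨V, hV, hVT⟩ := exists_nhds_inter_subset_identityComponent hHA hcl
  have hcont : Continuous fun m : Grp K => h⁻¹ * m := continuous_const.mul continuous_id
  have hh' : h ∈ closure ((S ⊔ U : Subgroup (Grp K)) : Set (Grp K)) := by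
    rw [← Subgroup.topologicalClosure_coe, hHdef]
    exact hh
  obtain ⟨m, hmV, hm⟩ := mem_closure_iff_nhds.1 hh' _
    (hcont.continuousAt.preimage_mem_nhds (by rwa [inv_mul_cancel]))
  obtain ⟨s, hs, u, hu, rfl⟩ := mem_sup_of_commute
    (fun s hs u hu => diagonalGrp_comm (hS hs) (hU hu)) hm
  have ht : h⁻¹ * (s * u) ∈ identityComponent H := hVT ⟨hmV, H.mul_mem (H.inv_mem hh) (hle hm)⟩
  refine ⟨s * (h⁻¹ * (s * u))⁻¹, Subgroup.mul_mem _ (hST hs) (Subgroup.inv_mem _ ht), u, hu, ?_⟩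
  have hc := diagonalGrp_comm (hHA (identityComponent_le H (Subgroup.inv_mem _ ht))) (hU hu)
  rw [mul_assoc, hc]
  group

/-- The closure of the orbit of a rational point under a connected subgroup `S` of `D` is the
orbit of the identity component of the closure of `S U`, for `U` the group of diagonal matrices
fixing the point. -/
theorem exists_closure_orbit_eq {S : Subgroup (Grp K)} (hS : S ≤ torus Set.univ)
    (hSc : IsConnected (S : Set (Grp K))) (γ : Matrix.SpecialLinearGroup (Fin 2) K) :
    ∃ T : Subgroup (Grp K), T ≤ torus Set.univ ∧ IsClosed (T : Set (Grp K)) ∧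
      IsConnected (T : Set (Grp K)) ∧
      closure (MulAction.orbit S (proj (diagonalEmbedding K γ))) =
        MulAction.orbit T (proj (diagonalEmbedding K γ)) := by
  have hSA : S ≤ diagonalGrp K := hS.trans torus_le_diagonalGrp
  have hUA : diagonalStabilizer γ ≤ diagonalGrp K := inf_le_left
  have hux {u : Grp K} (hu : u ∈ diagonalStabilizer γ) :
      u • proj (diagonalEmbedding K γ) = proj (diagonalEmbedding K γ) := hu.2
  have hHA : (S ⊔ diagonalStabilizer γ).topologicalClosure ≤ diagonalGrp K :=
    Subgroup.topologicalClosure_minimal _ (sup_le hSA hUA) isClosed_diagonalGrp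
  have hTc := isConnected_identityComponent (S ⊔ diagonalStabilizer γ).topologicalClosure
  refine ⟨identityComponent (S ⊔ diagonalStabilizer γ).topologicalClosure,
    le_torus_univ_of_isConnected hTc ((identityComponent_le _).trans hHA),
    isClosed_identityComponent (Subgroup.isClosed_topologicalClosure _), hTc,
    Set.Subset.antisymm ?_ ?_⟩
  · intro y hy
    obtain ⟨g, rfl⟩ : ∃ g, proj g = y := QuotientGroup.mk_surjective y
    obtain ⟨c, hc, hgc⟩ := exists_mul_mem_closure hSA γ hy
    obtain ⟨t, ht, u, hu, htu⟩ := exists_mul_of_mem_topologicalClosure hSA hSc hUA hgc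
    refine ⟨⟨t, ht⟩, ?_⟩
    change t • proj (diagonalEmbedding K γ) = proj g
    have e : proj g = (g * c⁻¹) • proj c := by rw [smul_proj, inv_mul_cancel_right]
    rw [e, htu, hc, mul_smul, hux hu]
  · rintro _ ⟨⟨t, ht⟩, rfl⟩
    have hcont : Continuous fun m : Grp K => m • proj (diagonalEmbedding K γ) := by
      fun_prop
    have ht' : t ∈ closure ((S ⊔ diagonalStabilizer γ : Subgroup (Grp K)) : Set (Grp K)) :=
      identityComponent_le _ ht
    refine map_mem_closure (f := fun m : Grp K => m • proj (diagonalEmbedding K γ)) hcont ht'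
      fun m hm => ?_
    obtain ⟨s, hs, u, hu, rfl⟩ := mem_sup_of_commute
      (fun s hs u hu => diagonalGrp_comm (hSA hs) (hUA hu)) hm
    refine ⟨⟨s, hs⟩, ?_⟩
    change s • proj (diagonalEmbedding K γ) = (s * u) • proj (diagonalEmbedding K γ)
    rw [mul_smul, hux hu]

/-- If `g ∈ N_G(D_I) G_K` then the closure of the orbit of `π(g)` under a connected subgroup
of `D_I` is an orbit of a torus. -/
theorem isTorusOrbit_closure_orbit {I : Set (InfinitePlace K)} {S : Subgroup (Grp K)}
    (hS : S ≤ torus I) (hSc : IsConnected (S : Set (Grp K))) {g : Grp K}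
    (hg : g ∈ normalizerMulRational (torus I)) :
    IsTorusOrbit (closure (MulAction.orbit S (proj g))) := by
  obtain ⟨γ, hγ⟩ := mem_normalizerMulRational.1 hg
  set n := g * diagonalEmbedding K γ
  have hcont : Continuous (MulAut.conj n⁻¹).toMonoidHom := by
    change Continuous fun x => n⁻¹ * x * (n⁻¹)⁻¹
    fun_prop
  obtain ⟨T, hTD, hTcl, hTc, hT⟩ := exists_closure_orbit_eq
    (S := S.map (MulAut.conj n⁻¹).toMonoidHom) (by
      rintro _ ⟨s, hs, rfl⟩
      exact torus_le_univ I (conj_mem_torus (fun v hv => (hγ v hv).inv) (hS hs)))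
    (hSc.image _ hcont.continuousOn) γ⁻¹
  have horb (S : Subgroup (Grp K)) (x : Space K) :
      MulAction.orbit (S.map (MulAut.conj n).toMonoidHom) (n • x) = n • MulAction.orbit S x := by
    ext y
    constructor
    · rintro ⟨⟨_, s, hs, rfl⟩, rfl⟩
      refine ⟨s • x, ⟨⟨s, hs⟩, rfl⟩, ?_⟩
      change n • s • x = (n * s * n⁻¹) • n • x
      simp only [smul_smul, inv_mul_cancel_right]
    · rintro ⟨_, ⟨⟨s, hs⟩, rfl⟩, rfl⟩
      refine ⟨⟨_, s, hs, rfl⟩, ?_⟩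
      change (n * s * n⁻¹) • n • x = n • s • x
      simp only [smul_smul, inv_mul_cancel_right]
  have hx : proj g = n • proj (diagonalEmbedding K γ⁻¹) := by
    rw [smul_proj]
    simp [n, mul_assoc]
  refine ⟨T.map (MulAut.conj n).toMonoidHom, proj g, ⟨n, T, hTD, hTcl, hTc, rfl⟩, ?_⟩
  have hS' : S = (S.map (MulAut.conj n⁻¹).toMonoidHom).map (MulAut.conj n).toMonoidHom := by
    rw [Subgroup.map_map]
    convert (Subgroup.map_id S).symm
    ext x : 1
    simp [mul_assoc]
  rw [hx, horb, ← hT, ← closure_smul, ← horb, ← hS']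

end OrbitClosure

/-! ### Closed orbits of tori -/

section ClosedOrbits

variable {K : Type*} [Field K]

lemma IsTorus.isClosed {T : Subgroup (Grp K)} (hT : IsTorus T) : IsClosed (T : Set (Grp K)) := by
  obtain ⟨h, S, -, hS, -, rfl⟩ := hT
  have : ((S.map (MulAut.conj h).toMonoidHom : Subgroup (Grp K)) : Set (Grp K)) =
      (fun x => h⁻¹ * x * h) ⁻¹' S := by
    ext x
    constructor
    · rintro ⟨s, hs, rfl⟩
      simpa [mul_assoc] using hs
    · intro hx
      exact ⟨_, hx, by simp [mul_assoc]⟩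
  rw [this]
  exact hS.preimage ((continuous_const.mul continuous_id).mul continuous_const)

lemma IsTorus.mul_comm {T : Subgroup (Grp K)} (hT : IsTorus T) {a b : Grp K} (ha : a ∈ T)
    (hb : b ∈ T) : a * b = b * a := by
  obtain ⟨h, S, hS, -, -, rfl⟩ := hT
  obtain ⟨s, hs, rfl⟩ := ha
  obtain ⟨t, ht, rfl⟩ := hb
  rw [← map_mul, ← map_mul,
    diagonalGrp_comm (torus_le_diagonalGrp (hS hs)) (torus_le_diagonalGrp (hS ht))]

variable [NumberField K]

/-- The orbit map onto a closed orbit of a closed subgroup is open, by Baire's theorem. -/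
lemma isOpenMap_orbit {T : Subgroup (Grp K)} (hT : IsClosed (T : Set (Grp K))) {x : Space K}
    (hX : IsClosed (MulAction.orbit T x)) :
    IsOpenMap fun t : T => (⟨t • x, MulAction.mem_orbit x t⟩ : MulAction.orbit T x) := by
  have : SigmaCompactSpace T := hT.isClosedEmbedding_subtypeVal.sigmaCompactSpace
  have : LocallyCompactSpace (MulAction.orbit T x) :=
    hX.isClosedEmbedding_subtypeVal.locallyCompactSpace
  have : ContinuousSMul T (MulAction.orbit T x) := ⟨by
    refine Continuous.subtype_mk
      (f := fun p : T × MulAction.orbit T x => (p.1 : Grp K) • (p.2 : Space K)) ?_ _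
    exact (continuous_subtype_val.comp continuous_fst).smul
      (continuous_subtype_val.comp continuous_snd)⟩
  exact isOpenMap_smul_of_sigmaCompact (⟨x, MulAction.mem_orbit_self x⟩ : MulAction.orbit T x)

/-- A closed orbit carries the quotient topology: the part of it in a compact set is the image of
a bounded part of the group. -/
lemma exists_bounded_mem_of_smul_mem {T : Subgroup (Grp K)} (hT : IsClosed (T : Set (Grp K)))
    {x : Space K} (hX : IsClosed (MulAction.orbit T x)) {C : Set (Space K)} (hC : IsCompact C) :
    ∃ R : ℝ, ∀ t ∈ T, t • x ∈ C → ∃ t' ∈ T, t' • x = t • x ∧ ∀ v i j, ‖t' v i j‖ ≤ R := by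
  obtain ⟨n, hn⟩ := (hX.isClosedEmbedding_subtypeVal.isCompact_preimage hC).elim_directed_cover
    (fun n : ℕ => (fun t : T => (⟨t • x, MulAction.mem_orbit x t⟩ : MulAction.orbit T x)) ''
      (Subtype.val ⁻¹' {g : Grp K | ∀ v i j, ‖g v i j‖ < n}))
    (fun n => isOpenMap_orbit hT hX _ ((isOpen_entries_lt _).preimage continuous_subtype_val))
    (by
      rintro ⟨_, t, rfl⟩ _
      obtain ⟨n, hn⟩ := exists_entries_lt (t : Grp K)
      exact Set.mem_iUnion.2 ⟨n, t, hn, rfl⟩)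
    (directed_of_isDirected_le fun m n hmn => Set.image_mono fun g hg v i j =>
      (hg v i j).trans_le (by exact_mod_cast hmn))
  refine ⟨n, fun t ht htC => ?_⟩
  obtain ⟨t', ht', he⟩ := hn
    (show (⟨t • x, MulAction.mem_orbit x (⟨t, ht⟩ : T)⟩ : MulAction.orbit T x) ∈ _ from htC)
  exact ⟨t', t'.2, congrArg Subtype.val he, fun v i j => (ht' v i j).le⟩

lemma exists_nhds_conj_mem {G : Type*} [Group G] [TopologicalSpace G] [IsTopologicalGroup G] (g : G)
    {V : Set G} (hV : V ∈ nhds 1) :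
    ∃ U ∈ nhds (1 : G), ∀ a ∈ U, ∀ b ∈ U, (a * g)⁻¹ * (b * g) ∈ V := by
  have hcont : Continuous fun p : G × G => (p.1 * g)⁻¹ * (p.2 * g) := by fun_prop
  have hnhds := hcont.continuousAt.preimage_mem_nhds (x := ((1 : G), (1 : G))) (t := V)
    (by simpa using hV)
  rw [nhds_prod_eq, Filter.mem_prod_same_iff] at hnhds
  obtain ⟨U, hU, hUV⟩ := hnhds
  exact ⟨U, hU, fun a ha b hb => hUV (Set.mk_mem_prod ha hb)⟩

/-- Elements near the identity are determined by their effect on a given point of `G / Γ`. -/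
lemma exists_nhds_smul_proj_injOn (g : Grp K) :
    ∃ U ∈ nhds (1 : Grp K), Set.InjOn (fun u => u • proj g) U := by
  obtain ⟨V, hV, hs⟩ := exists_nhds_Gam_subsingleton (1 : Grp K)
  obtain ⟨U, hU, hUV⟩ := exists_nhds_conj_mem g hV
  refine ⟨U, hU, fun a ha b hb hab => ?_⟩
  have h1 : (a * g)⁻¹ * (b * g) ∈ Gam K := QuotientGroup.eq.1 hab
  have h2 := hs ⟨h1, hUV a ha b hb⟩ ⟨(Gam K).one_mem, mem_of_mem_nhds hV⟩
  exact mul_right_cancel (inv_mul_eq_one.1 h2)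

/-- A one-parameter group that preserves a closed orbit of `T` is contained in `T`. -/
lemma flow_mem_of_smul_mem_orbit {T : Subgroup (Grp K)} (hT : IsClosed (T : Set (Grp K)))
    {g : Grp K} (hX : IsClosed (MulAction.orbit T (proj g))) {c : InfinitePlace K → ℝ}
    (hc : ∀ s : ℝ, flow (s • c) • proj g ∈ MulAction.orbit T (proj g)) : flow c ∈ T := by
  obtain ⟨U, hU, hinj⟩ := exists_nhds_smul_proj_injOn g
  have hW := (isOpenMap_orbit hT hX).image_mem_nhds
    (continuous_subtype_val.continuousAt.preimage_mem_nhds (x := (1 : T)) hU)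
  have hcont' : Continuous fun s : ℝ => flow (s • c) • proj g := by
    have := continuous_flow_smul c
    fun_prop
  have hcont : Continuous fun s : ℝ =>
      (⟨flow (s • c) • proj g, hc s⟩ : MulAction.orbit T (proj g)) :=
    hcont'.subtype_mk _
  have e0 : (⟨flow ((0 : ℝ) • c) • proj g, hc 0⟩ : MulAction.orbit T (proj g)) =
      ⟨(1 : T) • proj g, MulAction.mem_orbit _ _⟩ := by
    refine Subtype.ext ?_
    change flow ((0 : ℝ) • c) • proj g = (1 : T) • proj g
    rw [zero_smul, flow_zero, one_smul, one_smul]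
  have h1 := hcont.continuousAt.preimage_mem_nhds (x := 0) (e0 ▸ hW)
  have h2 : (fun s : ℝ => flow (s • c)) ⁻¹' U ∈ nhds (0 : ℝ) :=
    (continuous_flow_smul c).continuousAt.preimage_mem_nhds (by rwa [zero_smul, flow_zero])
  obtain ⟨n, ⟨t, htU, ht⟩, hnU⟩ := ((tendsto_one_div_add_atTop_nhds_zero_nat (𝕜 := ℝ)).eventually
    (Filter.inter_mem h1 h2)).exists
  have h4 : (t : Grp K) = flow ((1 / ((n : ℝ) + 1)) • c) :=
    hinj htU hnU (congrArg Subtype.val ht)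
  -- For small parameters the flow is in `T`; hence so are its powers.
  have hpow (m : ℕ) (d : InfinitePlace K → ℝ) : flow ((m : ℝ) • d) = flow d ^ m := by
    induction m with
    | zero => simp [flow_zero]
    | succ m ih => rw [Nat.cast_succ, add_smul, one_smul, flow_add, ih, pow_succ]
  have h5 : flow c = (t : Grp K) ^ (n + 1) := by
    rw [h4, ← hpow, smul_smul, Nat.cast_succ, mul_one_div_cancel (by positivity), one_smul]
  rw [h5]
  exact T.pow_mem t.2 _

end ClosedOrbits

/-! ### Rays that stay bounded -/

section BoundedRay

variable {K : Type*} [Field K]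

/-- A matrix commuting with a diagonal matrix that is not scalar is diagonal. -/
lemma diagonal_of_commute {v : InfinitePlace K} {m : LocalGroup v}
    (h : m * boost v 1 = boost v 1 * m) : m 0 1 = 0 ∧ m 1 0 = 0 := by
  have key (i j : Fin 2) := congrArg (fun x : LocalGroup v => x i j) h
  simp only [Matrix.SpecialLinearGroup.coe_mul, Matrix.mul_apply, Fin.sum_univ_two] at key
  have h01 := key 0 1
  have h10 := key 1 0
  simp only [boost_zero_zero, boost_zero_one, boost_one_zero, boost_one_one, mul_zero, zero_mul,
    zero_add, add_zero] at h01 h10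
  have hne : realEmbedding v (Real.exp 1) - realEmbedding v (Real.exp (-1)) ≠ 0 := by
    rw [sub_ne_zero, (realEmbedding v).injective.ne_iff, Ne, Real.exp_eq_exp]
    norm_num
  constructor
  · refine (mul_eq_zero.1 ?_).resolve_left hne
    linear_combination -h01
  · refine (mul_eq_zero.1 ?_).resolve_left hne
    linear_combination h10

/-- A flow contracts vectors by at most `e^{-|c_v|}`. -/
lemma exp_neg_abs_mul_norm_le (c : InfinitePlace K → ℝ) (g : Grp K) (w : Fin 2 → K)
    (v : InfinitePlace K) :
    Real.exp (-|c v|) * ‖evalVec g w v‖ ≤ ‖evalVec (flow c * g) w v‖ := by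
  rw [mul_comm, ← le_div_iff₀ (Real.exp_pos _), pi_norm_le_iff_of_nonneg (by positivity)]
  intro j
  rw [le_div_iff₀ (Real.exp_pos _), mul_comm]
  refine le_trans ?_ (norm_le_pi_norm _ j)
  fin_cases j
  · change _ ≤ ‖evalVec (flow c * g) w v 0‖
    rw [norm_evalVec_flow_mul_zero]
    exact mul_le_mul_of_nonneg_right (Real.exp_le_exp.2 (neg_abs_le _)) (norm_nonneg _)
  · change _ ≤ ‖evalVec (flow c * g) w v 1‖
    rw [norm_evalVec_flow_mul_one]
    exact mul_le_mul_of_nonneg_right (Real.exp_le_exp.2 (neg_le_neg (le_abs_self _)))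
      (norm_nonneg _)

/-- If `g_i` is the product of a diagonal and a rational matrix, but the same
rational matrix does not make `g_{i'}` monomial, then the elements of `G` with diagonal components
at `i` and `i'` that fix `π(g)` are scalars `±1`. -/
lemma exists_eq_mul_of_smul_proj_eq {g : Grp K} {i i' : InfinitePlace K}
    {β : Matrix.SpecialLinearGroup (Fin 2) K}
    (hi : (g * diagonalEmbedding K β) i 0 1 = 0 ∧ (g * diagonalEmbedding K β) i 1 0 = 0)
    (hi' : ¬ IsMonomial ((g * diagonalEmbedding K β) i')) {t : Grp K}
    (ht : t i 0 1 = 0 ∧ t i 1 0 = 0) (ht' : t i' 0 1 = 0 ∧ t i' 1 0 = 0)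
    (h : t • proj g = proj g) :
    ∃ a : K, a ^ 2 = 1 ∧ ∀ (x : Grp K) v j k, (x * t) v j k = x v j k * algebraMap K _ a := by
  have h' : proj g = proj (t * g) := h.symm
  obtain ⟨δ, hδ⟩ := proj_eq_iff.1 h'
  set m := g * diagonalEmbedding K β with hm
  -- `γ` is diagonal because of the component at `i`, and scalar because of the one at `i'`.
  set γ := β⁻¹ * intMatrix δ * β
  have htm : t * m = m * diagonalEmbedding K γ := by
    simp only [hm, γ, map_mul, map_inv]
    rw [← mul_assoc, hδ]
    group
  have hmi : (m i)⁻¹ 0 1 = 0 ∧ (m i)⁻¹ 1 0 = 0 := (diagonalSubgroup i).inv_mem hi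
  have hγi : (diagonalEmbedding K γ i) 0 1 = 0 ∧ (diagonalEmbedding K γ i) 1 0 = 0 := by
    have e : diagonalEmbedding K γ i = (m i)⁻¹ * (t i * m i) := by
      have e1 : t i * m i = m i * diagonalEmbedding K γ i := congrFun htm i
      rw [e1, inv_mul_cancel_left]
    rw [e]
    exact (diagonalSubgroup i).mul_mem hmi ((diagonalSubgroup i).mul_mem ht hi)
  have hγ : γ 0 1 = 0 ∧ γ 1 0 = 0 := by
    simpa only [diagonalEmbedding_apply, map_eq_zero] using hγi
  have heq : γ 0 0 = γ 1 1 := by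
    by_contra hne
    refine hi' (isMonomial_of_conj_diagonal (d := diagonalEmbedding K γ i') (e := t i') ?_ ?_
      (congrFun htm i').symm ht')
    · simp only [diagonalEmbedding_apply, hγ, map_zero, and_self]
    · simpa only [diagonalEmbedding_apply, Ne, (algebraMap_injective i').eq_iff] using hne
  have hdet := diagonal_mul_eq_one hγ
  refine ⟨γ 0 0, by rw [sq]; nth_rw 2 [heq]; exact hdet, ?_⟩
  have hscal (x : Grp K) (v j k) :
      (x * diagonalEmbedding K γ) v j k = x v j k * algebraMap K _ (γ 0 0) := by
    rw [Pi.mul_apply, Matrix.SpecialLinearGroup.coe_mul, Matrix.mul_apply, Fin.sum_univ_two]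
    simp only [diagonalEmbedding_apply]
    obtain rfl | rfl : k = 0 ∨ k = 1 := by omega
    · rw [hγ.2, map_zero, mul_zero, add_zero]
    · rw [hγ.1, ← heq, map_zero, mul_zero, zero_add]
  have hcomm : m * diagonalEmbedding K γ = diagonalEmbedding K γ * m := by
    refine funext fun v => Matrix.SpecialLinearGroup.ext _ _ fun j k => ?_
    have e : (diagonalEmbedding K γ * m) v j k = diagonalEmbedding K γ v j 0 * m v 0 k +
        diagonalEmbedding K γ v j 1 * m v 1 k := by
      rw [Pi.mul_apply, Matrix.SpecialLinearGroup.coe_mul, Matrix.mul_apply, Fin.sum_univ_two]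
    refine (hscal m v j k).trans (Eq.trans ?_ e.symm)
    rw [diagonalEmbedding_apply, diagonalEmbedding_apply]
    obtain rfl | rfl : j = 0 ∨ j = 1 := by omega
    · rw [hγ.1, map_zero, zero_mul, add_zero, mul_comm]
    · rw [hγ.2, ← heq, map_zero, zero_mul, zero_add, mul_comm]
  have htγ : t = diagonalEmbedding K γ := mul_right_cancel (htm.trans hcomm)
  rw [htγ]
  exact hscal

variable [NumberField K]

/-- Lower bounds for the components of `g w` in terms of those of `x ∈ K`, with weights that
cancel out, bound the height of `w`. -/
lemma mul_abs_norm_le_height {g : Grp K} {w : Fin 2 → K} {κ : ℝ} (hκ : 0 ≤ κ)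
    {a : InfinitePlace K → ℝ} (ha : ∑ v, (v.mult : ℝ) * a v = 0) {x : K}
    (h : ∀ v, κ * Real.exp (a v) * ‖algebraMap K v.Completion x‖ ≤ ‖evalVec g w v‖) :
    (∏ v : InfinitePlace K, κ ^ v.mult) * |(Algebra.norm ℚ x : ℝ)| ≤ height g w := by
  have he : ∏ v : InfinitePlace K, Real.exp (a v) ^ v.mult = 1 := by
    simp_rw [← Real.exp_nat_mul]
    rw [← Real.exp_sum, ha, Real.exp_zero]
  rw [← prod_norm_algebraMap, ← mul_one (∏ v : InfinitePlace K, κ ^ v.mult), ← he,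
    ← Finset.prod_mul_distrib, ← Finset.prod_mul_distrib, height]
  refine Finset.prod_le_prod (fun v _ => by positivity) fun v _ => ?_
  rw [← mul_pow, ← mul_pow]
  exact pow_le_pow_left₀ (by positivity) (h v) _

/-- If one component of `h` is diagonal, then for a suitable flow, which moves only that component
and another one, the vectors of `h K²` do not become small: the line contracted at
the first place is expanded at the second one, and vectors off this line are expanded at the first
place, at a rate that compensates for the contraction at the second. -/
lemma exists_ray_le_height {h : Grp K} {i i' : InfinitePlace K} (hii' : i ≠ i')
    (hi : h i 0 1 = 0 ∧ h i 1 0 = 0) :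
    ∃ c : InfinitePlace K → ℝ, 0 < c i ∧ (∀ v, v ≠ i → v ≠ i' → c v = 0) ∧
      ∃ κ > 0, ∀ u : Fin 2 → K, u ≠ 0 → ∃ j, u j ≠ 0 ∧ ∀ s : ℝ, 0 ≤ s →
        κ * |(Algebra.norm ℚ (u j) : ℝ)| ≤ height (flow (s • c) * h) u := by
  classical
  -- `k` is the coordinate that the flow expands at `i'`, and `a` has weighted sum zero, so that the
  -- exponents cancel in the product over all places.
  obtain ⟨k, hk⟩ : ∃ k, h i' k 1 ≠ 0 := by
    by_contra! h0
    have := det_eq_one (h i')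
    simp [h0] at this
  set σ : ℝ := if k = 0 then 1 else -1 with hσ
  set c : InfinitePlace K → ℝ := Pi.single i (i'.mult : ℝ) + Pi.single i' (σ * i.mult) with hc
  set a : InfinitePlace K → ℝ := Pi.single i (i'.mult : ℝ) - Pi.single i' (i.mult : ℝ) with ha
  have hci : c i = i'.mult := by simp [hc, hii']
  have hci' : c i' = σ * i.mult := by simp [hc, hii'.symm]
  have hai : a i = i'.mult := by simp [ha, hii']
  have hai' : a i' = -i.mult := by simp [ha, hii'.symm]
  have hσ1 : |σ| = 1 := by simp only [hσ]; split_ifs <;> simp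
  have habs (v) : |c v| = |a v| := by
    by_cases h1 : v = i
    · rw [h1, hci, hai]
    by_cases h2 : v = i'
    · rw [h2, hci', hai', abs_mul, hσ1, one_mul, abs_neg]
    simp [hc, ha, h1, h2]
  have hsum : ∑ v, (v.mult : ℝ) * a v = 0 := by
    simp only [ha, Pi.sub_apply, mul_sub, Finset.sum_sub_distrib]
    rw [Finset.sum_eq_single i (by intro v _ hv; simp [hv]) (by simp),
      Finset.sum_eq_single i' (by intro v _ hv; simp [hv]) (by simp)]
    simp [mul_comm]
  obtain ⟨n, hn⟩ := exists_entries_lt h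
  have hn0 : (0 : ℝ) < n := (norm_nonneg _).trans_lt (hn i 0 0)
  have hi0 : h i 0 0 ≠ 0 := diagonal_ne_zero hi
  set κ : ℝ := min (2 * n : ℝ)⁻¹ (min ‖h i 0 0‖ ‖h i' k 1‖)
  have hκ : 0 < κ := lt_min (by positivity) (lt_min (norm_pos_iff.2 hi0) (norm_pos_iff.2 hk))
  have hκn : κ ≤ (2 * n : ℝ)⁻¹ := min_le_left _ _
  have hκi : κ ≤ ‖h i 0 0‖ := (min_le_right _ _).trans (min_le_left _ _)
  have hκi' : κ ≤ ‖h i' k 1‖ := (min_le_right _ _).trans (min_le_right _ _)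
  -- The bound that holds for all vectors at all places.
  have gen (u : Fin 2 → K) (j : Fin 2) (s : ℝ) (hs : 0 ≤ s) (v : InfinitePlace K) :
      κ * Real.exp (-(s * |c v|)) * ‖algebraMap K v.Completion (u j)‖ ≤
        ‖evalVec (flow (s • c) * h) u v‖ := by
    refine le_trans ?_ (exp_neg_abs_mul_norm_le _ _ _ _)
    rw [Pi.smul_apply, smul_eq_mul, abs_mul, abs_of_nonneg hs, mul_comm κ, mul_assoc]
    refine mul_le_mul_of_nonneg_left ?_ (Real.exp_pos _).le
    refine (mul_le_mul_of_nonneg_right hκn (norm_nonneg _)).trans ?_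
    rw [inv_mul_le_iff₀ (by positivity)]
    exact (norm_le_pi_norm (fun j => algebraMap K v.Completion (u j)) j).trans
      (norm_le_norm_mulVec (fun i j => (hn v i j).le) _)
  refine ⟨c, by rw [hci]; exact_mod_cast i'.mult_pos, fun v h1 h2 => by simp [hc, h1, h2],
    ∏ v : InfinitePlace K, κ ^ v.mult, Finset.prod_pos fun v _ => by positivity, fun u hu => ?_⟩
  by_cases hu0 : u 0 = 0
  · have hu1 : u 1 ≠ 0 := fun h1 => hu (funext fun j => by fin_cases j <;> simp [hu0, h1])
    refine ⟨1, hu1, fun s hs => mul_abs_norm_le_height hκ.le (a := -(s • a)) ?_ fun v => ?_⟩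
    · simp only [Pi.neg_apply, Pi.smul_apply, smul_eq_mul, mul_neg, Finset.sum_neg_distrib]
      rw [neg_eq_zero, ← mul_zero s, ← hsum, Finset.mul_sum]
      exact Finset.sum_congr rfl fun v _ => by ring
    · by_cases hv : v = i'
      · subst hv
        have e : evalVec h u v k = h v k 1 * algebraMap K v.Completion (u 1) := by
          rw [evalVec_apply, hu0, map_zero, mul_zero, zero_add]
        have e2 : ‖evalVec (flow (s • c) * h) u v k‖ =
            Real.exp (s * i.mult) * ‖evalVec h u v k‖ := by
          by_cases hk0 : k = 0
          · rw [hk0, norm_evalVec_flow_mul_zero, Pi.smul_apply, hci', hσ, if_pos hk0, one_mul,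
              smul_eq_mul]
          · have hk1 : k = 1 := by omega
            rw [hk1, norm_evalVec_flow_mul_one, Pi.smul_apply, hci', hσ, if_neg hk0, smul_eq_mul]
            congr 2
            ring
        refine le_trans ?_ (norm_le_pi_norm _ k)
        rw [e2, e, norm_mul, Pi.neg_apply, Pi.smul_apply, hai', smul_eq_mul, mul_neg, neg_neg,
          mul_comm κ, mul_assoc]
        gcongr
      · have hle : -(s • a) v ≤ -(s * |c v|) ∨ v = i' := by
          left
          rw [habs, Pi.smul_apply, smul_eq_mul]
          have : 0 ≤ a v := by
            by_cases h1 : v = i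
            · rw [h1, hai]; positivity
            · simp [ha, h1, hv]
          rw [abs_of_nonneg this]
        refine le_trans ?_ (gen u 1 s hs v)
        have := hle.resolve_right hv
        simp only [Pi.neg_apply]
        gcongr
  · refine ⟨0, hu0, fun s hs => mul_abs_norm_le_height hκ.le (a := s • a) ?_ fun v => ?_⟩
    · simp only [Pi.smul_apply, smul_eq_mul]
      rw [← mul_zero s, ← hsum, Finset.mul_sum]
      exact Finset.sum_congr rfl fun v _ => by ring
    · by_cases hv : v = i
      · subst hv
        refine le_trans ?_ (norm_le_pi_norm _ 0)
        rw [norm_evalVec_flow_mul_zero, evalVec_apply, hi.1, zero_mul, add_zero, norm_mul,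
          Pi.smul_apply, Pi.smul_apply, hai, hci, mul_comm κ, mul_assoc]
        gcongr
      · refine le_trans ?_ (gen u 0 s hs v)
        have hle : (s • a) v ≤ -(s * |c v|) := by
          rw [habs, Pi.smul_apply, smul_eq_mul]
          have : a v ≤ 0 := by
            by_cases h1 : v = i'
            · rw [h1, hai', neg_nonpos]; positivity
            · simp [ha, h1, hv]
          rw [abs_of_nonpos this, mul_neg, neg_neg]
        gcongr

/-- If one component of `g` is the product of a diagonal and a rational matrix, then a suitable
ray of the flow along that component and another one keeps `π(g)` in a compact set. -/
lemma exists_bounded_ray {g : Grp K} {i i' : InfinitePlace K} (hii' : i ≠ i')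
    {β : Matrix.SpecialLinearGroup (Fin 2) K}
    (hi : (g * diagonalEmbedding K β) i 0 1 = 0 ∧ (g * diagonalEmbedding K β) i 1 0 = 0) :
    ∃ c : InfinitePlace K → ℝ, 0 < c i ∧ (∀ v, v ≠ i → v ≠ i' → c v = 0) ∧
      ∃ C : Set (Space K), IsCompact C ∧ ∀ s : ℝ, 0 ≤ s → flow (s • c) • proj g ∈ C := by
  obtain ⟨c, hc, hc0, κ, hκ, h⟩ := exists_ray_le_height hii' hi
  obtain ⟨D, hD, G, hG⟩ := exists_common_denominator β⁻¹
  have hDn := one_le_abs_norm hD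
  obtain ⟨R, hR⟩ := exists_bounded_mul_of_le_height K
    (ε := κ / |(Algebra.norm ℚ (D : K) : ℝ)|) (by positivity)
  refine ⟨c, hc, hc0, _, (isCompact_entries_le R).image continuous_proj, fun s hs => ?_⟩
  obtain ⟨δ, hδ⟩ := hR (flow (s • c) * g) fun w hw => by
    obtain ⟨j, hj, hj'⟩ := h _ (mulVec_ne_zero β⁻¹ (intVec_ne_zero hw))
    have e : height (flow (s • c) * (g * diagonalEmbedding K β)) (β⁻¹.1.mulVec (intVec w)) =
        height (flow (s • c) * g) (intVec w) := by
      rw [← mul_assoc, height_mul_diagonalEmbedding, Matrix.mulVec_mulVec,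
        ← Matrix.SpecialLinearGroup.coe_mul, mul_inv_cancel, Matrix.SpecialLinearGroup.coe_one,
        Matrix.one_mulVec]
    rw [← e]
    refine le_trans ?_ (hj' s hs)
    rw [div_le_iff₀ (by positivity), mul_assoc]
    refine le_mul_of_one_le_right hκ.le ?_
    have ez : ((G j 0 * w 0 + G j 1 * w 1 : 𝓞 K) : K) = D * β⁻¹.1.mulVec (intVec w) j := by
      simp only [map_add, map_mul, hG, Matrix.mulVec, dotProduct, Fin.sum_univ_two, intVec]
      ring
    have hz : G j 0 * w 0 + G j 1 * w 1 ≠ 0 := by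
      intro h0
      rw [h0] at ez
      exact mul_ne_zero (by simpa using hD) hj (ez.symm.trans (map_zero (algebraMap (𝓞 K) K)))
    have := one_le_abs_norm hz
    rw [ez, map_mul, Rat.cast_mul, abs_mul] at this
    rwa [mul_comm]
  exact ⟨_, hδ, (proj_eq_iff.2 ⟨δ, rfl⟩).symm⟩

end BoundedRay

/-! ### Orbits whose closure is an orbit of a torus -/

section TorusOrbits

variable {K : Type*} [Field K] [NumberField K]

/-- If the closure of the orbit of `π(g)` under a group containing `D_{I,ℝ}` is an orbit of a
torus and the orbit is locally divergent then `g ∈ N_G(D_I) G_K`. -/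
theorem mem_normalizerMulRational_of_isTorusOrbit {I : Set (InfinitePlace K)} (hI : I.Nonempty)
    {S : Subgroup (Grp K)} (hS : realTorus I ≤ S) {g : Grp K}
    (hg : ∀ v ∈ I, g ∈ normalizerMulRational (torus {v}))
    (h : IsTorusOrbit (closure (MulAction.orbit S (proj g)))) :
    g ∈ normalizerMulRational (torus I) := by
  classical
  obtain ⟨T, x, hT, hTx⟩ := h
  -- The base point of the torus orbit may be taken to be `π(g)`.
  have hgx : proj g ∈ MulAction.orbit T x := hTx ▸ subset_closure (MulAction.mem_orbit_self _)
  rw [← MulAction.orbit_eq_iff.2 hgx] at hTx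
  have hX : IsClosed (MulAction.orbit T (proj g)) := hTx ▸ isClosed_closure
  have hflow {c : InfinitePlace K → ℝ} (hc : ∀ v ∉ I, c v = 0) : flow c ∈ T := by
    refine flow_mem_of_smul_mem_orbit hT.isClosed hX fun s => ?_
    rw [← hTx]
    exact subset_closure ⟨⟨_, hS (flow_mem_realTorus fun v hv => by simp [hc v hv])⟩, rfl⟩
  have hdiag {t : Grp K} (ht : t ∈ T) {v : InfinitePlace K} (hv : v ∈ I) :
      t v 0 1 = 0 ∧ t v 1 0 = 0 := by
    refine diagonal_of_commute ?_
    have hf : flow (Pi.single v (1 : ℝ)) ∈ T :=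
      hflow fun w hw => Pi.single_eq_of_ne (by grind) _
    simpa [flow] using congrFun (hT.mul_comm ht hf) v
  obtain ⟨i, hi⟩ := hI
  obtain ⟨⟨w, hw0, hw⟩, w', hw0', hw'⟩ :=
    exists_lines_of_isDivergentOrbit (isDivergentOrbit_iff.2 (hg i hi))
  obtain ⟨β, hβ⟩ := exists_diagonal_of_lines hw0 hw0' hw hw'
  refine mem_normalizerMulRational.2 ⟨β, ?_⟩
  by_contra! hcon
  obtain ⟨i', hi', hmon⟩ := hcon
  have hii' : i ≠ i' := by
    rintro rfl
    exact hmon ⟨by rw [hβ.1, mul_zero], by rw [hβ.2, zero_mul]⟩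
  obtain ⟨c, hci, hc0, C, hC, hray⟩ := exists_bounded_ray hii' hβ
  obtain ⟨R, hR⟩ := exists_bounded_mem_of_smul_mem hT.isClosed hX hC
  -- As the stabilizer of `π(g)` in `T` is `±1`, the ray is bounded in `T`.
  have hbound (s : ℝ) (hs : 0 ≤ s) : Real.exp (s * c i) ≤ R := by
    have hsT : flow (s • c) ∈ T := hflow fun v hv => by
      rw [Pi.smul_apply, hc0 v (by grind) (by grind), smul_zero]
    obtain ⟨t, ht, hts, htR⟩ := hR _ hsT (hray s hs)
    have hz := T.mul_mem (T.inv_mem hsT) ht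
    obtain ⟨a, ha, hmul⟩ := exists_eq_mul_of_smul_proj_eq hβ hmon (hdiag hz hi) (hdiag hz hi')
      (by rw [mul_smul, hts, inv_smul_smul])
    have h1 := htR i 0 0
    have h2 := hmul (flow (s • c)) i 0 0
    rw [mul_inv_cancel_left] at h2
    have h3 : ‖algebraMap K i.Completion a‖ = 1 := by
      rw [← pow_eq_one_iff_of_nonneg (norm_nonneg _) two_ne_zero, ← norm_pow, ← map_pow, ha,
        map_one, norm_one]
    rw [h2, norm_mul, h3, mul_one] at h1
    simpa [flow, norm_realEmbedding] using h1
  have h1 := hbound (|R| / c i) (by positivity)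
  rw [div_mul_cancel₀ _ hci.ne'] at h1
  linarith [Real.add_one_le_exp |R|, le_abs_self R]

lemma isLocallyDivergent_iff {I : Set (InfinitePlace K)} {g : Grp K} :
    IsLocallyDivergent I (proj g) ↔ ∀ v ∈ I, g ∈ normalizerMulRational (torus {v}) :=
  forall₂_congr fun _ _ => isDivergentOrbit_iff

end TorusOrbits

end HilbertModular

theorem corollary6 (K : Type*) [Field K] [NumberField K]
    (hr : 2 ≤ Fintype.card (InfinitePlace K))
    (I : Set (InfinitePlace K)) (hI : I.Nonempty) (g : HilbertModular.Grp K) :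
    (HilbertModular.IsLocallyDivergent I (HilbertModular.proj g) →
      (HilbertModular.IsTorusOrbit
          (closure (MulAction.orbit (HilbertModular.torus I) (HilbertModular.proj g))) ↔
        g ∈ HilbertModular.normalizerMulRational (HilbertModular.torus I)) ∧
      (HilbertModular.IsTorusOrbit
          (closure (MulAction.orbit (HilbertModular.realTorus I) (HilbertModular.proj g))) ↔
        g ∈ HilbertModular.normalizerMulRational (HilbertModular.torus I))) ∧
    ((HilbertModular.IsLocallyDivergent I (HilbertModular.proj g) ∧
        ¬ HilbertModular.IsTorusOrbit
          (closure (MulAction.orbit (HilbertModular.torus I) (HilbertModular.proj g)))) ↔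
      g ∈ (⋂ v ∈ I, HilbertModular.normalizerMulRational (HilbertModular.torus {v})) \
        HilbertModular.normalizerMulRational (HilbertModular.torus I)) := by
  have key (hg : HilbertModular.IsLocallyDivergent I (HilbertModular.proj g))
      {S : Subgroup (HilbertModular.Grp K)} (hS : HilbertModular.realTorus I ≤ S)
      (hS' : S ≤ HilbertModular.torus I) (hSc : IsConnected (S : Set (HilbertModular.Grp K))) :
      HilbertModular.IsTorusOrbit (closure (MulAction.orbit S (HilbertModular.proj g))) ↔
        g ∈ HilbertModular.normalizerMulRational (HilbertModular.torus I) :=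
    ⟨HilbertModular.mem_normalizerMulRational_of_isTorusOrbit hI hS
      (HilbertModular.isLocallyDivergent_iff.1 hg),
      HilbertModular.isTorusOrbit_closure_orbit hS' hSc⟩
  have hD (hg : HilbertModular.IsLocallyDivergent I (HilbertModular.proj g)) :=
    key hg (HilbertModular.realTorus_le I) le_rfl (HilbertModular.isConnected_torus I)
  refine ⟨fun hg => ⟨hD hg, key hg le_rfl (HilbertModular.realTorus_le I)
    (HilbertModular.isConnected_realTorus I)⟩, ?_⟩
  rw [Set.mem_sdiff, Set.mem_iInter₂, ← HilbertModular.isLocallyDivergent_iff]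
  exact and_congr_right fun hg => not_congr (hD hg)

end
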